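/- Notation. Let $n\ge 1$. For a measure $\mu$ on $\mathbb R^n$ and a measurable $f$ let $f^*_\mu(t)=\inf\{s>0:\mu\{|f|>s\}\le t\}$, $t>0$, and write $f^*$ when $\mu$ is Lebesgue measure. For $1\le p<\infty$ and a weight $u$, with $d\mu=u\,dx$, put $$\|f\|_{L^{p,1}(u)}=\int_0^\infty f^*_\mu(s)\,s^{\frac1p-1}\,ds,\qquad \|f\|_{L^{p,\infty}(u)}=\sup_{t>0}t^{\frac1p}f^*_\mu(t),$$ and omit $u$ when $u=1$. For $1<p<\infty$, $A_p$ is the class of a.e. positive, locally integrable $u$ with $$\|u\|_{A_p}=\sup_Q\Big(\frac1{|Q|}\int_Q u\Big)\Big(\frac1{|Q|}\int_Q u^{-\frac1{p-1}}\Big)^{p-1}<\infty,$$ the supremum being over all cubes $Q\subset\mathbb R^n$ with sides parallel to the axes. A function $\varphi:[1,\infty)\to[1,\infty)$ is admissible if it is differentiable, $\varphi(1)=1$, $\log\varphi$ is concave, and there are $\gamma,\beta>0$ with $\frac\gamma x\le\frac{\varphi'(x)}{\varphi(x)}\le\frac\beta x$ for all $x\ge1$. Theorem. Let $1<p_0<\infty$,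 let $\varphi$ be admissible, and let $C_1,C_2\ge 0$. Let $\mathcal D$ be the linear span of $L^1(\mathbb R^n)$ and of all the spaces $L^{p_0,1}(u)$, $u\in A_{p_0}$ (real- or complex-valued functions). There is a constant $C$, depending only on $n,p_0,\varphi,C_1,C_2$, with the following property. Let $T$ be an operator from measurable functions to functions that is sublinear on $\mathcal D$, that is, for $f,g\in\mathcal D$ and scalars $\lambda$, $Tf$ is measurable and, a.e., $|T(f+g)|\le|Tf|+|Tg|$ and $|T(\lambda f)|=|\lambda||Tf|$. Suppose that $$\|Tf\|_{L^{1,\infty}}\le C_1\|f\|_{L^1}\quad (f\in L^1),$$ $$\|Tf\|_{L^{p_0,\infty}(u)}\le C_2\,\varphi(\|u\|_{A_{p_0}})\,\|f\|_{L^{p_0,1}(u)}\quad (u\in A_{p_0},\ f\in L^{p_0,1}(u)).$$ Then $$(Tf)^*(t)\le C\left(\frac1t\int_0^t f^*(s)\,ds+\int_t^\infty\Big(1+\log\frac st\Big)^{-1}\varphi\Big(1+\log\frac st\Big)f^*(s)\,\frac{ds}s\right)\qquad(1.2)$$ for every $t>0$ and every $f\in\mathcal D$, and also for every measurable $f\notin\mathcal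 D$ at which $T$ is a limit of its values on $\mathcal D$ in the sense that there are $g_k\in\mathcal D$ with $|g_k|\le|f|$, $g_k\to f$ and $|Tf|\le\liminf_k|Tg_k|$ a.e. -/

import Mathlib

open MeasureTheory Set Filter Topology
open scoped ENNReal NNReal

noncomputable section

namespace WeakToPointwise

/-- Admissible functions `φ : [1, ∞) → [1, ∞)`. The values of `φ` to the left of `1` play no role;
at the endpoint `1` the derivative is the one-sided one. -/
structure IsAdmissible (φ : ℝ → ℝ) : Prop where
  one_le : ∀ x, 1 ≤ x → 1 ≤ φ x
  map_one : φ 1 = 1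
  logConcave : ConcaveOn ℝ (Ici 1) (fun x => Real.log (φ x))
  differentiable : DifferentiableOn ℝ φ (Ici 1)
  logDeriv_bounds : ∃ γ β : ℝ, 0 < γ ∧ 0 < β ∧ ∀ x, 1 ≤ x →
    γ / x ≤ derivWithin φ (Ici 1) x / φ x ∧ derivWithin φ (Ici 1) x / φ x ≤ β / x

section Rearrangement

variable {X E : Type*} [MeasurableSpace X] [NormedAddCommGroup E]

/-- The decreasing rearrangement of `f` with respect to `μ`:
`f^*(t) = inf {s ≥ 0 : μ {|f| > s} ≤ t}`, with `inf ∅ = ∞`. -/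
def rearr (μ : Measure X) (f : X → E) (t : ℝ) : ℝ≥0∞ :=
  sInf {s : ℝ≥0∞ | μ {x | s < ‖f x‖ₑ} ≤ ENNReal.ofReal t}

/-- The Lorentz norm of `L^{p,1}(μ)`, namely `∫_0^∞ f^*(s) s^{1/p - 1} ds`. -/
def lorentzOneNorm (p : ℝ) (μ : Measure X) (f : X → E) : ℝ≥0∞ :=
  ∫⁻ s in Ioi (0 : ℝ), rearr μ f s * ENNReal.ofReal (s ^ (1 / p - 1))

/-- The Lorentz quasi-norm of `L^{p,∞}(μ)`, namely `sup_{t > 0} f^*(t) t^{1/p}`. -/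
def lorentzWeakNorm (p : ℝ) (μ : Measure X) (f : X → E) : ℝ≥0∞ :=
  ⨆ (t : ℝ) (_ : 0 < t), rearr μ f t * ENNReal.ofReal (t ^ (1 / p))

end Rearrangement

/-- The closed cube in `ℝⁿ` with sides parallel to the axes, lower corner `a`, side length `r`. -/
def cube {n : ℕ} (a : Fin n → ℝ) (r : ℝ) : Set (Fin n → ℝ) :=
  Icc a (fun i => a i + r)

/-- The `A_p` constant of `u` (`1 < p < ∞`): the supremum over all cubes `Q` of
`(⨍_Q u) (⨍_Q u^{-1/(p-1)})^{p-1}`. -/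
def muckenhouptConst {n : ℕ} (p : ℝ) (u : (Fin n → ℝ) → ℝ≥0∞) : ℝ≥0∞ :=
  ⨆ (a : Fin n → ℝ) (r : ℝ) (_ : 0 < r),
    (⨍⁻ x in cube a r, u x ∂volume) *
      (⨍⁻ x in cube a r, (u x) ^ (-(1 / (p - 1))) ∂volume) ^ (p - 1)

/-- `u ∈ A_p`: a weight (measurable, a.e. positive and finite, locally integrable) whose
`A_p` constant is finite. -/
structure IsMuckenhoupt {n : ℕ} (p : ℝ) (u : (Fin n → ℝ) → ℝ≥0∞) : Prop where
  measurable : Measurable u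
  pos : ∀ᵐ x, 0 < u x
  finite : ∀ᵐ x, u x < ∞
  locallyIntegrable : ∀ (a : Fin n → ℝ) (r : ℝ), ∫⁻ x in cube a r, u x < ∞
  const_lt_top : muckenhouptConst p u < ∞

/-- The measure `u dx`, so that `L^{p,q}(u)` is `L^{p,q}` of this measure. -/
abbrev weighted {n : ℕ} (u : (Fin n → ℝ) → ℝ≥0∞) : Measure (Fin n → ℝ) :=
  volume.withDensity u

variable {𝕜 : Type*} [RCLike 𝕜]

/-- `f ∈ L^{p,1}(u)`. As `u` is positive and finite a.e. for `u ∈ A_p`, (Lebesgue) measurability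
with respect to `dx` and with respect to `u dx` are the same. -/
def MemLorentzOne {n : ℕ} (p : ℝ) (u : (Fin n → ℝ) → ℝ≥0∞) (f : (Fin n → ℝ) → 𝕜) : Prop :=
  AEStronglyMeasurable f volume ∧ lorentzOneNorm p (weighted u) f < ∞

/-- The linear span of `L^1` and of all the spaces `L^{p,1}(u)`, `u ∈ A_p`. -/
def lorentzSum (𝕜 : Type*) [RCLike 𝕜] (n : ℕ) (p : ℝ) : Submodule 𝕜 ((Fin n → ℝ) → 𝕜) :=
  Submodule.span 𝕜
    ({f | MemLp f 1 volume} ∪ {f | ∃ u, IsMuckenhoupt p u ∧ MemLorentzOne p u f})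

/-- `T` is a sublinear operator, with measurable values, on the linear space `D` of functions. -/
structure IsSublinearOn {n : ℕ} (D : Submodule 𝕜 ((Fin n → ℝ) → 𝕜))
    (T : ((Fin n → ℝ) → 𝕜) → ((Fin n → ℝ) → 𝕜)) : Prop where
  aestronglyMeasurable : ∀ f ∈ D, AEStronglyMeasurable (T f) volume
  add_le : ∀ f ∈ D, ∀ g ∈ D, ∀ᵐ x, ‖T (f + g) x‖ ≤ ‖T f x‖ + ‖T g x‖
  smul_eq : ∀ (c : 𝕜), ∀ f ∈ D, ∀ᵐ x, ‖T (c • f) x‖ = ‖c‖ * ‖T f x‖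

/-- `T f` is controlled by the values of `T` on `D`: there are `g_k ∈ D` with `|g_k| ≤ |f|`,
`g_k → f` and `|T f| ≤ liminf |T g_k|`, almost everywhere. -/
def IsLimitFrom {n : ℕ} (D : Submodule 𝕜 ((Fin n → ℝ) → 𝕜))
    (T : ((Fin n → ℝ) → 𝕜) → ((Fin n → ℝ) → 𝕜)) (f : (Fin n → ℝ) → 𝕜) : Prop :=
  ∃ g : ℕ → (Fin n → ℝ) → 𝕜, (∀ k, g k ∈ D) ∧
    (∀ k, ∀ᵐ x, ‖g k x‖ ≤ ‖f x‖) ∧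
    (∀ᵐ x, Tendsto (fun k => g k x) atTop (𝓝 (f x))) ∧
    (∀ᵐ x, ‖T f x‖ₑ ≤ liminf (fun k => ‖T (g k) x‖ₑ) atTop)

/-- `P h (t) = (1/t) ∫_0^t h(s) ds`. -/
def hardyP (h : ℝ → ℝ≥0∞) (t : ℝ) : ℝ≥0∞ :=
  ENNReal.ofReal (1 / t) * ∫⁻ s in Ioo 0 t, h s

/-- `Q h (t) = ∫_t^∞ (1 + log (s/t))⁻¹ φ(1 + log (s/t)) h(s) ds/s`. -/
def calderonQ (φ : ℝ → ℝ) (h : ℝ → ℝ≥0∞) (t : ℝ) : ℝ≥0∞ :=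
  ∫⁻ s in Ioi t,
    ENNReal.ofReal ((1 + Real.log (s / t))⁻¹ * φ (1 + Real.log (s / t))) * h s *
      ENNReal.ofReal (1 / s)

end WeakToPointwise

end

noncomputable section

namespace WeakToPointwise

/-! ### Rearrangements and Lorentz norms on a general measure space -/

section Rearrangement

variable {X E : Type*} [MeasurableSpace X] [NormedAddCommGroup E] {μ : Measure X}

/-! The operator is tested on an arbitrary level set, with weights adapted to that set. Fix `λ <
(Tf)^*(t)` and choose `E ⊆ {|Tf| > λ}` of finite measure `s ≥ t`. Cut `f` horizontally at the
heights `a_k = f^*(t e^{2^k - 1})`. The part of `f` above `a_0` has `L^1` norm at most `∫_0^t f^*`,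
and the weak (1,1) bound turns it into the Hardy term.

The slice between `a_{k+1}` and `a_k` is bounded by `a_k` and lives on a set of measure at most `t
e^{2^{k+1} - 1}`. With `δ = 2^{-(k+1)}`, use the weight `u = 1_E + δ (M 1_E)^{1-δ}`. It is at least
`1` on `E`; its `A_p` constant is `O(1/δ)` (`muckenhouptConst_testWeight_le`); and every set of
Lebesgue measure at most `|E| e^{1/δ - 1}` has `u`-measure `O(|E|)` (`weighted_testWeight_le`). So
the exponentially large support costs nothing, and `∫_E |T(slice_k)| ≲ |E| φ(2^{k+1}) a_k`
(`setLIntegral_enorm_le_of_bounded`). Both properties of `u` come from the weak (1,1) bound for `M`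
through Kolmogorov's inequality; the factor `δ` absorbs the `1/δ` that the latter produces.

Integrals over `E` add up, unlike weak norms. The resulting sum of `φ(2^{k+1}) a_k` is a
discretisation of the right-hand side, because `1 + log(s/t)` doubles from one scale to the next
(`tsum_mul_scale_le`). Chebyshev's inequality on `E` then bounds `λ`.

Sublinearity is only finite, so the infinite sum of slices needs an argument of its own: order
continuity of the `L^1` and Lorentz norms makes `T` of the remainders tend to zero almost everywhere
along a subsequence (`exists_seq_tendsto_indicator`, `enorm_le_tsum_slice`). -/

theorem rearr_antitone (μ : Measure X) (f : X → E) : Antitone (rearr μ f) := fun _ _ hst =>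
  sInf_le_sInf fun _ hr => le_trans hr (ENNReal.ofReal_le_ofReal hst)

theorem rearr_le_of_measure_le {f : X → E} {t : ℝ} {s : ℝ≥0∞}
    (h : μ {x | s < ‖f x‖ₑ} ≤ ENNReal.ofReal t) : rearr μ f t ≤ s :=
  sInf_le h

/-- The infimum is attained: along a sequence decreasing to it the superlevel sets increase, and
continuity from below needs no finiteness of `μ`. -/
theorem measure_rearr_lt_le (μ : Measure X) (f : X → E) (t : ℝ) :
    μ {x | rearr μ f t < ‖f x‖ₑ} ≤ ENNReal.ofReal t := by
  set S : Set ℝ≥0∞ := {s : ℝ≥0∞ | μ {x | s < ‖f x‖ₑ} ≤ ENNReal.ofReal t} with hS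
  have hne : S.Nonempty := ⟨∞, by simp [hS]⟩
  obtain ⟨v, hv, hlim, hmem⟩ := exists_seq_tendsto_sInf hne (OrderBot.bddBelow S)
  have hsub : {x | rearr μ f t < ‖f x‖ₑ} ⊆ ⋃ k, {x | v k < ‖f x‖ₑ} := by
    intro x hx
    have : ∀ᶠ k in atTop, v k < ‖f x‖ₑ := (tendsto_order.1 hlim).2 _ hx
    obtain ⟨k, hk⟩ := this.exists
    exact mem_iUnion.2 ⟨k, hk⟩
  refine (measure_mono hsub).trans ?_
  have hmono : Monotone fun k => {x | v k < ‖f x‖ₑ} := fun i j hij x hx =>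
    lt_of_le_of_lt (hv hij) hx
  rw [hmono.measure_iUnion]
  exact iSup_le hmem

theorem measure_le_of_rearr_le {f : X → E} {t : ℝ} {s : ℝ≥0∞} (h : rearr μ f t ≤ s) :
    μ {x | s < ‖f x‖ₑ} ≤ ENNReal.ofReal t :=
  (measure_mono fun _ hx => lt_of_le_of_lt h hx).trans (measure_rearr_lt_le μ f t)

theorem rearr_mono_ae {f g : X → E} (h : ∀ᵐ x ∂μ, ‖g x‖ₑ ≤ ‖f x‖ₑ) (t : ℝ) :
    rearr μ g t ≤ rearr μ f t := by
  refine rearr_le_of_measure_le ((measure_mono_ae ?_).trans (measure_rearr_lt_le μ f t))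
  filter_upwards [h] with x hx hlt
  exact lt_of_lt_of_le hlt hx

/-- The layer cake formula for extended nonnegative functions. -/
theorem lintegral_eq_lintegral_measure_ofReal_lt {g : X → ℝ≥0∞} (hg : AEMeasurable g μ) :
    ∫⁻ x, g x ∂μ = ∫⁻ r in Ioi (0 : ℝ), μ {x | ENNReal.ofReal r < g x} := by
  by_cases htop : μ {x | g x = ∞} = 0
  · have hfin : ∀ᵐ x ∂μ, g x ≠ ∞ := by
      rw [ae_iff]; simpa using htop
    have h1 : ∫⁻ x, g x ∂μ = ∫⁻ x, ENNReal.ofReal (g x).toReal ∂μ := by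
      refine lintegral_congr_ae ?_
      filter_upwards [hfin] with x hx
      rw [ENNReal.ofReal_toReal hx]
    rw [h1, lintegral_eq_lintegral_meas_lt μ (ae_of_all _ fun _ => ENNReal.toReal_nonneg)
      hg.ennreal_toReal]
    refine setLIntegral_congr_fun measurableSet_Ioi fun r hr => measure_congr ?_
    filter_upwards [hfin] with x hx
    exact propext (ENNReal.ofReal_lt_iff_lt_toReal (le_of_lt hr) hx).symm
  · have h1 : ∫⁻ x, g x ∂μ = ∞ := by
      by_contra h
      refine htop ?_
      have := ae_lt_top' hg h
      rw [ae_iff] at this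
      simpa using this
    rw [h1, eq_comm, eq_top_iff]
    calc ∞ = ∫⁻ _ in Ioi (0 : ℝ), μ {x | g x = ∞} := by
            rw [setLIntegral_const, Real.volume_Ioi, ENNReal.mul_top htop]
      _ ≤ _ := by
            refine lintegral_mono fun r => measure_mono fun x hx => ?_
            simp only [mem_ofPred_eq] at hx ⊢
            rw [hx]; exact ENNReal.ofReal_lt_top

/-- If `w` dominates the rearrangement of `g`, then `∫_F g ≤ ∫_0^m w` for `μ F ≤ m`. -/
theorem setLIntegral_le_setLIntegral_Ioo {g : X → ℝ≥0∞} (hg : AEMeasurable g μ) {w : ℝ → ℝ≥0∞}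
    (hw : Measurable w) (h : ∀ s, 0 < s → μ {x | w s < g x} ≤ ENNReal.ofReal s)
    {F : Set X} {m : ℝ} (hF : μ F ≤ ENNReal.ofReal m) :
    ∫⁻ x in F, g x ∂μ ≤ ∫⁻ s in Ioo 0 m, w s := by
  rw [lintegral_eq_lintegral_measure_ofReal_lt hg.restrict,
    lintegral_eq_lintegral_measure_ofReal_lt hw.aemeasurable]
  refine lintegral_mono fun r => ?_
  set R := ENNReal.ofReal r
  have hle : μ.restrict F {x | R < g x} ≤ ENNReal.ofReal m :=
    (measure_mono (subset_univ _)).trans (by simpa using hF)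
  have hne : μ.restrict F {x | R < g x} ≠ ∞ := (lt_of_le_of_lt hle ENNReal.ofReal_lt_top).ne
  set c := (μ.restrict F {x | R < g x}).toReal with hc
  have hcm : c ≤ max m 0 := by
    rw [hc]
    refine ENNReal.toReal_le_of_le_ofReal (le_max_right _ _) (hle.trans ?_)
    exact ENNReal.ofReal_le_ofReal (le_max_left _ _)
  -- Levels are compared one at a time. If `w s ≤ R` for some `s < c`, the hypothesis would give
  -- measure at most `s` to a set of measure `c`.
  have hsub : Ioo 0 c ⊆ {s | R < w s} ∩ Ioo 0 m := by
    rintro s ⟨hs0, hsc⟩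
    have hsm : s < m := by
      rcases le_max_iff.1 hcm with h' | h' <;> linarith
    refine ⟨?_, hs0, hsm⟩
    by_contra hcon
    have hcon : w s ≤ R := not_lt.1 hcon
    have h2 : μ.restrict F {x | R < g x} ≤ ENNReal.ofReal s :=
      (Measure.restrict_apply_le _ _).trans
        ((measure_mono fun x hx => lt_of_le_of_lt hcon hx).trans (h s hs0))
    have := ENNReal.toReal_le_of_le_ofReal hs0.le h2
    linarith
  calc μ.restrict F {x | R < g x} = ENNReal.ofReal c := (ENNReal.ofReal_toReal hne).symm
    _ = volume (Ioo 0 c) := by rw [Real.volume_Ioo, sub_zero]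
    _ ≤ volume ({s | R < w s} ∩ Ioo 0 m) := measure_mono hsub
    _ = _ := (Measure.restrict_apply (measurableSet_lt measurable_const hw)).symm

theorem setLIntegral_enorm_le_rearr {f : X → E} (hf : AEStronglyMeasurable f μ)
    {F : Set X} {m : ℝ} (hF : μ F ≤ ENNReal.ofReal m) :
    ∫⁻ x in F, ‖f x‖ₑ ∂μ ≤ ∫⁻ s in Ioo 0 m, rearr μ f s :=
  setLIntegral_le_setLIntegral_Ioo hf.enorm (rearr_antitone μ f).measurable
    (fun s _ => measure_rearr_lt_le μ f s) hF

theorem lintegral_Ioo_rpow {a m : ℝ} (ha : 0 < a) (hm : 0 ≤ m) :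
    ∫⁻ s in Ioo 0 m, ENNReal.ofReal (s ^ (a - 1)) = ENNReal.ofReal (m ^ a / a) := by
  have hint : IntervalIntegrable (fun s : ℝ => s ^ (a - 1)) volume 0 m :=
    intervalIntegral.intervalIntegrable_rpow' (by linarith)
  rw [restrict_Ioo_eq_restrict_Ioc, ← ofReal_integral_eq_lintegral_ofReal
    ((intervalIntegrable_iff_integrableOn_Ioc_of_le hm).1 hint)]
  · rw [← intervalIntegral.integral_of_le hm, integral_rpow (Or.inl (by linarith))]
    simp [Real.zero_rpow ha.ne']
  · filter_upwards [ae_restrict_mem measurableSet_Ioc] with s hs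
    exact Real.rpow_nonneg hs.1.le _

theorem rearr_le_lorentzWeakNorm {p : ℝ} {f : X → E} {s : ℝ} (hs : 0 < s) :
    rearr μ f s ≤ lorentzWeakNorm p μ f * ENNReal.ofReal (s ^ (-(1 / p))) := by
  have h1 : rearr μ f s * ENNReal.ofReal (s ^ (1 / p)) ≤ lorentzWeakNorm p μ f :=
    le_iSup₂ (f := fun (t : ℝ) (_ : 0 < t) => rearr μ f t * ENNReal.ofReal (t ^ (1 / p))) s hs
  calc rearr μ f s = rearr μ f s * ENNReal.ofReal (s ^ (1 / p))
        * ENNReal.ofReal (s ^ (-(1 / p))) := by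
        rw [mul_assoc, ← ENNReal.ofReal_mul (Real.rpow_nonneg hs.le _), ← Real.rpow_add hs]
        simp
    _ ≤ _ := by gcongr

/-- The bound `s^{-1/p}` on the rearrangement is integrable at `0` because `p > 1`. This replaces
the weak quasi-norm by an integral over a set, which is countably additive in the function. -/
theorem setLIntegral_enorm_le_lorentzWeakNorm {p : ℝ} (hp : 1 < p) {f : X → E}
    (hf : AEStronglyMeasurable f μ) {F : Set X} {m : ℝ} (hm : 0 ≤ m)
    (hF : μ F ≤ ENNReal.ofReal m) :
    ∫⁻ x in F, ‖f x‖ₑ ∂μ ≤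
      lorentzWeakNorm p μ f * ENNReal.ofReal (m ^ (1 - 1 / p) / (1 - 1 / p)) := by
  have hp' : 0 < 1 - 1 / p := by
    rw [sub_pos, div_lt_one (by linarith)]; exact hp
  calc ∫⁻ x in F, ‖f x‖ₑ ∂μ ≤ ∫⁻ s in Ioo 0 m, rearr μ f s := setLIntegral_enorm_le_rearr hf hF
    _ ≤ ∫⁻ s in Ioo 0 m, lorentzWeakNorm p μ f * ENNReal.ofReal (s ^ ((1 - 1 / p) - 1)) := by
        refine setLIntegral_mono' measurableSet_Ioo fun s hs => ?_
        convert rearr_le_lorentzWeakNorm (p := p) hs.1 using 4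
        ring
    _ = _ := by
        rw [lintegral_const_mul _ (by fun_prop), lintegral_Ioo_rpow hp' hm]

/-- The rearrangement is at most `a` and vanishes from `m` on. -/
theorem lorentzOneNorm_le_of_le {p : ℝ} (hp : 0 < p) {f : X → E} {a : ℝ≥0∞} {m : ℝ} (hm : 0 ≤ m)
    (hfa : ∀ x, ‖f x‖ₑ ≤ a) (hsupp : μ {x | f x ≠ 0} ≤ ENNReal.ofReal m) :
    lorentzOneNorm p μ f ≤ a * ENNReal.ofReal (p * m ^ (1 / p)) := by
  have hzero : ∀ s, m ≤ s → rearr μ f s = 0 := fun s hs => by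
    refine le_antisymm (rearr_le_of_measure_le ?_) bot_le
    simpa using hsupp.trans (ENNReal.ofReal_le_ofReal hs)
  have hle : ∀ s, rearr μ f s ≤ a := fun s => rearr_le_of_measure_le (by
    have : {x | a < ‖f x‖ₑ} = ∅ := by ext x; simpa using hfa x
    simp [this])
  calc lorentzOneNorm p μ f
      ≤ ∫⁻ s in Ioi (0 : ℝ), (Ioo 0 m).indicator
          (fun s => a * ENNReal.ofReal (s ^ (1 / p - 1))) s := by
        refine setLIntegral_mono' measurableSet_Ioi fun s hs => ?_
        by_cases hsm : s < m
        · rw [indicator_of_mem (show s ∈ Ioo 0 m from ⟨hs, hsm⟩)]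
          gcongr
          exact hle s
        · simp [hzero s (not_lt.1 hsm)]
    _ ≤ ∫⁻ s, (Ioo 0 m).indicator (fun s => a * ENNReal.ofReal (s ^ (1 / p - 1))) s :=
        setLIntegral_le_lintegral _ _
    _ = a * ENNReal.ofReal (p * m ^ (1 / p)) := by
        rw [lintegral_indicator measurableSet_Ioo, lintegral_const_mul _ (by fun_prop),
          lintegral_Ioo_rpow (by positivity) hm]
        congr 2
        field_simp

/-- Kolmogorov's inequality. -/
theorem setLIntegral_rpow_le_of_weak {g : X → ℝ≥0∞} (hg : AEMeasurable g μ) {A m δ : ℝ}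
    (hA : 0 ≤ A) (hm : 0 ≤ m) (hδ : 0 < δ) (hδ' : δ ≤ 1)
    (h : ∀ s, 0 < s → μ {x | ENNReal.ofReal (A / s) < g x} ≤ ENNReal.ofReal s)
    {F : Set X} (hF : μ F ≤ ENNReal.ofReal m) :
    ∫⁻ x in F, g x ^ (1 - δ) ∂μ ≤ ENNReal.ofReal (A ^ (1 - δ) * (m ^ δ / δ)) := by
  calc ∫⁻ x in F, g x ^ (1 - δ) ∂μ ≤ ∫⁻ s in Ioo 0 m, ENNReal.ofReal (A / s) ^ (1 - δ) := by
        refine setLIntegral_le_setLIntegral_Ioo (hg.pow_const _) (by fun_prop) (fun s hs => ?_) hF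
        refine (measure_mono fun x hx => ?_).trans (h s hs)
        simp only [mem_ofPred_eq] at hx ⊢
        exact lt_of_not_ge fun hle =>
          absurd hx (not_lt.2 (ENNReal.rpow_le_rpow hle (by linarith)))
    _ = ∫⁻ s in Ioo 0 m, ENNReal.ofReal (A ^ (1 - δ)) * ENNReal.ofReal (s ^ (δ - 1)) := by
        refine setLIntegral_congr_fun measurableSet_Ioo fun s hs => ?_
        rw [ENNReal.ofReal_rpow_of_nonneg (div_nonneg hA hs.1.le) (by linarith),
          ← ENNReal.ofReal_mul (Real.rpow_nonneg hA _), Real.div_rpow hA hs.1.le,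
          show δ - 1 = -(1 - δ) by ring, Real.rpow_neg hs.1.le, div_eq_mul_inv]
    _ = _ := by
        rw [lintegral_const_mul _ (by fun_prop), lintegral_Ioo_rpow hδ hm,
          ← ENNReal.ofReal_mul (Real.rpow_nonneg hA _)]

/-- Convergence to zero in the weak Lorentz quasi-norm implies convergence in measure. -/
theorem tendstoInMeasure_of_lorentzWeakNorm {p : ℝ} {f : ℕ → X → E}
    (h : Tendsto (fun k => lorentzWeakNorm p μ (f k)) atTop (𝓝 0)) :
    TendstoInMeasure μ f atTop 0 := by
  refine tendstoInMeasure_of_ne_top fun ε hε hεt => ?_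
  rw [ENNReal.tendsto_nhds_zero]
  intro s hs
  wlog hst : s ≠ ∞ generalizing s
  · filter_upwards with k
    simp [not_not.1 hst]
  have hs' : 0 < s.toReal := ENNReal.toReal_pos hs.ne' hst
  have hlim : Tendsto (fun k => lorentzWeakNorm p μ (f k) *
      ENNReal.ofReal (s.toReal ^ (-(1 / p)))) atTop (𝓝 0) := by
    simpa using ENNReal.Tendsto.mul_const (b := ENNReal.ofReal (s.toReal ^ (-(1 / p)))) h
      (Or.inr ENNReal.ofReal_ne_top)
  filter_upwards [(tendsto_order.1 hlim).2 ε hε] with k hk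
  have h1 : rearr μ (f k) s.toReal < ε := (rearr_le_lorentzWeakNorm hs').trans_lt hk
  calc μ {x | ε ≤ edist (f k x) ((0 : X → E) x)}
      ≤ μ {x | rearr μ (f k) s.toReal < ‖f k x‖ₑ} := by
        refine measure_mono fun x hx => ?_
        simp only [mem_ofPred_eq, Pi.zero_apply, edist_zero_right] at hx ⊢
        exact h1.trans_le hx
    _ ≤ ENNReal.ofReal s.toReal := measure_rearr_lt_le _ _ _
    _ = s := ENNReal.ofReal_toReal hst

/-- Order continuity of the Lorentz norm. -/
theorem tendsto_lorentzOneNorm_indicator {p : ℝ} (hp : 0 < p) {f : X → E}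
    (hf : AEStronglyMeasurable f μ) (hfin : lorentzOneNorm p μ f < ∞) {G : ℕ → Set X}
    (hG : ∀ k, NullMeasurableSet (G k) μ) (hanti : Antitone G) (hempty : ⋂ k, G k = ∅) :
    Tendsto (fun k => lorentzOneNorm p μ ((G k).indicator f)) atTop (𝓝 0) := by
  -- Continuity from above will need superlevel sets of finite measure. Were one infinite, the
  -- rearrangement would stay above `ε` forever, and `s^{1/p - 1}` is not integrable at infinity.
  have hdist : ∀ ε : ℝ≥0∞, 0 < ε → μ {x | ε < ‖f x‖ₑ} ≠ ∞ := by
    intro ε hε htop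
    have hge : ∀ s, ε ≤ rearr μ f s := fun s => le_sInf fun r hr => by
      by_contra hcon
      have : ∞ ≤ ENNReal.ofReal s := htop.symm.le.trans
        ((measure_mono fun x hx => (not_le.1 hcon).trans hx).trans hr)
      exact absurd this (not_le.2 ENNReal.ofReal_lt_top)
    have hbd : ∀ m : ℝ, 0 ≤ m → ε * ENNReal.ofReal (p * m ^ (1 / p)) ≤ lorentzOneNorm p μ f := by
      intro m hm
      calc ε * ENNReal.ofReal (p * m ^ (1 / p))
          = ∫⁻ s in Ioo 0 m, ε * ENNReal.ofReal (s ^ (1 / p - 1)) := by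
            rw [lintegral_const_mul _ (by fun_prop), lintegral_Ioo_rpow (by positivity) hm]
            congr 2
            field_simp
        _ ≤ ∫⁻ s in Ioo 0 m, rearr μ f s * ENNReal.ofReal (s ^ (1 / p - 1)) := by
            refine lintegral_mono fun s => ?_
            dsimp only
            gcongr
            exact hge s
        _ ≤ _ := lintegral_mono_set Ioo_subset_Ioi_self
    have hlim : Tendsto (fun m : ℝ => ε * ENNReal.ofReal (p * m ^ (1 / p))) atTop (𝓝 (ε * ∞)) := by
      refine ENNReal.Tendsto.const_mul ?_ (Or.inl (by simp))
      exact ENNReal.tendsto_ofReal_nhds_top.2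
        ((tendsto_rpow_atTop (by positivity)).const_mul_atTop hp)
    rw [ENNReal.mul_top hε.ne'] at hlim
    have := le_of_tendsto hlim ((eventually_ge_atTop 0).mono hbd)
    exact absurd hfin (not_lt.2 this)
  have hlevel : ∀ s, 0 < s → Tendsto (fun k => rearr μ ((G k).indicator f) s) atTop (𝓝 0) := by
    intro s hs
    rw [ENNReal.tendsto_nhds_zero]
    intro ε hε
    have hcap : Tendsto (fun k => μ ({x | ε < ‖f x‖ₑ} ∩ G k)) atTop (𝓝 0) := by
      have := tendsto_measure_iInter_atTop (μ := μ) (s := fun k => {x | ε < ‖f x‖ₑ} ∩ G k)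
        (fun k => (nullMeasurableSet_lt aemeasurable_const hf.enorm).inter (hG k))
        (fun i j hij => inter_subset_inter_right _ (hanti hij))
        ⟨0, ((measure_mono inter_subset_left).trans_lt (hdist ε hε).lt_top).ne⟩
      rwa [← inter_iInter, hempty, inter_empty, measure_empty] at this
    filter_upwards [(tendsto_order.1 hcap).2 (ENNReal.ofReal s) (by simpa using hs)] with k hk
    refine rearr_le_of_measure_le ((measure_mono fun x hx => ?_).trans hk.le)
    by_cases hxG : x ∈ G k
    · simp only [mem_ofPred_eq, indicator_of_mem hxG] at hx
      exact ⟨hx, hxG⟩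
    · simp [indicator_of_notMem hxG] at hx
  have hmeas : ∀ g : X → E,
      Measurable fun s => rearr μ g s * ENNReal.ofReal (s ^ (1 / p - 1)) := fun g =>
    (rearr_antitone μ g).measurable.mul (by fun_prop)
  have := tendsto_lintegral_of_dominated_convergence (μ := volume.restrict (Ioi (0 : ℝ)))
    (F := fun k s => rearr μ ((G k).indicator f) s * ENNReal.ofReal (s ^ (1 / p - 1)))
    (f := fun _ => 0) (fun s => rearr μ f s * ENNReal.ofReal (s ^ (1 / p - 1)))
    (fun k => hmeas _) (fun k => ae_of_all _ fun s => by
      dsimp only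
      gcongr
      exact rearr_mono_ae (ae_of_all _ fun x => enorm_indicator_le_enorm_self _ _) s)
    hfin.ne (by
      filter_upwards [ae_restrict_mem measurableSet_Ioi] with s hs
      simpa using ENNReal.Tendsto.mul_const (b := ENNReal.ofReal (s ^ (1 / p - 1))) (hlevel s hs)
        (Or.inr ENNReal.ofReal_ne_top))
  simpa [lorentzOneNorm] using this

end Rearrangement

/-! ### The maximal function of an indicator and the `A₁` bound for its powers -/

section Maximal

open Metric

variable {n : ℕ}

/-- The uncentred Hardy–Littlewood maximal function of the indicator of `E`. -/
def maximalIndicator (E : Set (Fin n → ℝ)) (x : Fin n → ℝ) : ℝ≥0∞ :=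
  ⨆ (c : Fin n → ℝ) (r : ℝ) (_ : 0 < r) (_ : x ∈ ball c r),
    volume (E ∩ ball c r) / volume (ball c r)

theorem lt_maximalIndicator_iff {E : Set (Fin n → ℝ)} {x : Fin n → ℝ} {a : ℝ≥0∞} :
    a < maximalIndicator E x ↔
      ∃ c r, 0 < r ∧ x ∈ ball c r ∧ a < volume (E ∩ ball c r) / volume (ball c r) := by
  simp only [maximalIndicator, lt_iSup_iff, exists_prop]

theorem measurable_maximalIndicator (E : Set (Fin n → ℝ)) : Measurable (maximalIndicator E) := by
  refine measurable_of_Ioi fun a => IsOpen.measurableSet ?_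
  rw [isOpen_iff_mem_nhds]
  intro x hx
  obtain ⟨c, r, hr, hxr, ha⟩ := lt_maximalIndicator_iff.1 hx
  filter_upwards [isOpen_ball.mem_nhds hxr] with y hy
  exact lt_maximalIndicator_iff.2 ⟨c, r, hr, hy, ha⟩

theorem volume_ball_ne_zero {c : Fin n → ℝ} {r : ℝ} (hr : 0 < r) : volume (ball c r) ≠ 0 :=
  (measure_ball_pos volume c hr).ne'

theorem volume_ball_ne_top {c : Fin n → ℝ} {r : ℝ} : volume (ball c r) ≠ ∞ :=
  measure_ball_lt_top.ne

theorem maximalIndicator_le_one (E : Set (Fin n → ℝ)) (x : Fin n → ℝ) :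
    maximalIndicator E x ≤ 1 := by
  refine iSup₂_le fun c r => iSup₂_le fun hr _ => ?_
  exact ENNReal.div_le_of_le_mul (by rw [one_mul]; exact measure_mono inter_subset_right)

theorem div_le_maximalIndicator (E : Set (Fin n → ℝ)) {x c : Fin n → ℝ} {r : ℝ} (hr : 0 < r)
    (hx : x ∈ ball c r) : volume (E ∩ ball c r) / volume (ball c r) ≤ maximalIndicator E x :=
  le_iSup₂_of_le c r (le_iSup₂_of_le hr hx le_rfl)

theorem volume_inter_ball_le (E : Set (Fin n → ℝ)) {x c : Fin n → ℝ} {r : ℝ} (hr : 0 < r)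
    (hx : x ∈ ball c r) :
    volume (E ∩ ball c r) ≤ maximalIndicator E x * volume (ball c r) :=
  (ENNReal.div_le_iff (volume_ball_ne_zero hr) volume_ball_ne_top).1
    (div_le_maximalIndicator E hr hx)

theorem maximalIndicator_eq_zero {E : Set (Fin n → ℝ)} (hE : volume E = 0) (x : Fin n → ℝ) :
    maximalIndicator E x = 0 := by
  refine le_antisymm (iSup₂_le fun c r => iSup₂_le fun hr _ => ?_) bot_le
  rw [measure_mono_null inter_subset_left hE, ENNReal.zero_div]

/-- Large balls about `x` meet `E` in positive measure. This makes the test weight positive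
everywhere, not only on `E`. -/
theorem maximalIndicator_pos {E : Set (Fin n → ℝ)} (hE : volume E ≠ 0) (x : Fin n → ℝ) :
    0 < maximalIndicator E x := by
  have hmono : Monotone fun k : ℕ => E ∩ ball x (k + 1) := fun i j hij =>
    inter_subset_inter_right _ (ball_subset_ball (by gcongr))
  have hU : ⋃ k : ℕ, E ∩ ball x (k + 1) = E := by
    rw [← inter_iUnion]
    refine inter_eq_left.2 fun y _ => mem_iUnion.2 ?_
    obtain ⟨k, hk⟩ := exists_nat_gt (dist y x)
    exact ⟨k, mem_ball.2 (hk.trans (by linarith))⟩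
  obtain ⟨k, hk⟩ : ∃ k : ℕ, volume (E ∩ ball x (k + 1)) ≠ 0 := by
    by_contra! hcon
    exact hE (by rw [← hU]; exact measure_iUnion_null hcon)
  have hk0 : (0 : ℝ) < k + 1 := by positivity
  exact lt_of_lt_of_le (ENNReal.div_pos hk volume_ball_ne_top)
    (div_le_maximalIndicator E hk0 (mem_ball_self hk0))

theorem volume_ball_mul (c : Fin n → ℝ) {r k : ℝ} (hr : 0 < r) (hk : 0 < k) :
    volume (ball c (k * r)) = ENNReal.ofReal (k ^ n) * volume (ball c r) := by
  rw [Real.volume_pi_ball _ hr, Real.volume_pi_ball _ (mul_pos hk hr),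
    ← ENNReal.ofReal_mul (by positivity), Fintype.card_fin]
  congr 1
  rw [← mul_pow]
  ring

theorem volume_closedBall_eq (c : Fin n → ℝ) {r : ℝ} (hr : 0 < r) :
    volume (closedBall c r) = volume (ball c r) := by
  rw [Real.volume_pi_ball _ hr, Real.volume_pi_closedBall _ hr.le]

/-- The weak type `(1,1)` inequality for the maximal function. -/
theorem mul_volume_lt_maximalIndicator_le (hn : 1 ≤ n) (E : Set (Fin n → ℝ)) (hE : volume E ≠ ∞)
    (hEm : MeasurableSet E) {a : ℝ≥0∞} (ha : a ≠ 0) (hat : a ≠ ∞) :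
    a * volume {x | a < maximalIndicator E x} ≤ ENNReal.ofReal (4 ^ n) * volume E := by
  set t : Set ((Fin n → ℝ) × ℝ) := {q | 0 < q.2 ∧
    a < volume (E ∩ ball q.1 q.2) / volume (ball q.1 q.2)} with ht
  have hlow : ∀ q ∈ t, a * volume (ball q.1 q.2) ≤ volume (E ∩ ball q.1 q.2) := fun q hq =>
    (ENNReal.le_div_iff_mul_le (Or.inl (volume_ball_ne_zero hq.1))
      (Or.inl volume_ball_ne_top)).1 hq.2.le
  -- The covering lemma needs bounded radii. A selected ball has volume `(2r)^n ≤ |E|/a`, and `r ≤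
  -- (2r)^n` once `r > 1`; this uses `n ≥ 1`.
  have hR : ∀ q ∈ t, q.2 ≤ (volume E / a).toReal + 1 := by
    intro q hq
    by_contra! hcon
    have hv : volume (ball q.1 q.2) ≤ volume E / a := by
      rw [ENNReal.le_div_iff_mul_le (Or.inl ha) (Or.inl hat), mul_comm]
      exact (hlow q hq).trans (measure_mono inter_subset_left)
    rw [Real.volume_pi_ball _ hq.1, ENNReal.ofReal_le_iff_le_toReal
      (ENNReal.div_ne_top hE ha), Fintype.card_fin] at hv
    have h0 : 0 ≤ (volume E / a).toReal := ENNReal.toReal_nonneg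
    have h1 : q.2 ≤ (2 * q.2) ^ n :=
      (by linarith : q.2 ≤ 2 * q.2).trans (le_self_pow₀ (by linarith) (by omega))
    linarith
  obtain ⟨u, hut, hdisj, hcov⟩ := Vitali.exists_disjoint_subfamily_covering_enlargement_ball t
    (fun q => q.1) (fun q => q.2) _ hR 4 (by norm_num)
  have hcount : u.Countable := hdisj.countable_of_isOpen (fun _ _ => isOpen_ball)
    fun q hq => nonempty_ball.2 (hut hq).1
  have hsub : {x | a < maximalIndicator E x} ⊆ ⋃ q ∈ u, ball q.1 (4 * q.2) := by
    intro x hx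
    obtain ⟨c, r, hr, hxr, hlt⟩ := lt_maximalIndicator_iff.1 hx
    obtain ⟨q, hq, hsub⟩ := hcov (c, r) ⟨hr, hlt⟩
    exact mem_iUnion₂.2 ⟨q, hq, hsub hxr⟩
  have hdisj' : u.PairwiseDisjoint fun q => E ∩ ball q.1 q.2 := fun q hq q' hq' hne =>
    (hdisj hq hq' hne).mono inter_subset_right inter_subset_right
  have := hcount.to_subtype
  calc a * volume {x | a < maximalIndicator E x}
      ≤ a * ∑' q : u, volume (ball q.1.1 (4 * q.1.2)) := by
        gcongr
        exact (measure_mono hsub).trans (measure_biUnion_le _ hcount _)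
    _ = ENNReal.ofReal (4 ^ n) * ∑' q : u, a * volume (ball q.1.1 q.1.2) := by
        rw [← ENNReal.tsum_mul_left, ← ENNReal.tsum_mul_left]
        refine tsum_congr fun q => ?_
        rw [volume_ball_mul _ (hut q.2).1 (by norm_num)]
        ring
    _ ≤ ENNReal.ofReal (4 ^ n) * ∑' q : u, volume (E ∩ ball q.1.1 q.1.2) := by
        gcongr with q
        exact hlow _ (hut q.2)
    _ = ENNReal.ofReal (4 ^ n) * volume (⋃ q ∈ u, E ∩ ball q.1 q.2) := by
        rw [measure_biUnion hcount hdisj' fun q _ => hEm.inter measurableSet_ball]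
    _ ≤ ENNReal.ofReal (4 ^ n) * volume E := by
        gcongr
        exact iUnion₂_subset fun q _ => inter_subset_left

/-- The weak type inequality at height `4^n t / s`, in the form that Kolmogorov's inequality takes
as input. -/
theorem volume_div_lt_maximalIndicator_le (hn : 1 ≤ n) {E : Set (Fin n → ℝ)}
    (hEm : MeasurableSet E) {t : ℝ} (ht : 0 ≤ t) (hE : volume E = ENNReal.ofReal t) {s : ℝ}
    (hs : 0 < s) :
    volume {x | ENNReal.ofReal (4 ^ n * t / s) < maximalIndicator E x} ≤ ENNReal.ofReal s := by
  rcases ht.eq_or_lt with rfl | ht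
  · simp [maximalIndicator_eq_zero (hE.trans ENNReal.ofReal_zero)]
  have ha : 0 < 4 ^ n * t / s := by positivity
  have := mul_volume_lt_maximalIndicator_le hn E (hE ▸ ENNReal.ofReal_ne_top) hEm
    (ENNReal.ofReal_pos.2 ha).ne' ENNReal.ofReal_ne_top
  rw [hE, ← ENNReal.ofReal_mul (by positivity), mul_comm,
    ← ENNReal.le_div_iff_mul_le (Or.inl (ENNReal.ofReal_pos.2 ha).ne')
      (Or.inl ENNReal.ofReal_ne_top), ← ENNReal.ofReal_div_of_pos ha] at this
  convert this using 2
  field_simp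

theorem setLIntegral_maximalIndicator_rpow_le (hn : 1 ≤ n) {E : Set (Fin n → ℝ)}
    (hEm : MeasurableSet E) {t : ℝ} (ht : 0 ≤ t) (hE : volume E = ENNReal.ofReal t)
    {δ : ℝ} (hδ : 0 < δ) (hδ' : δ ≤ 1) {F : Set (Fin n → ℝ)} {m : ℝ} (hm : 0 ≤ m)
    (hF : volume F ≤ ENNReal.ofReal m) :
    ∫⁻ x in F, maximalIndicator E x ^ (1 - δ) ≤
      ENNReal.ofReal ((4 ^ n * t) ^ (1 - δ) * (m ^ δ / δ)) :=
  setLIntegral_rpow_le_of_weak (measurable_maximalIndicator E).aemeasurable (by positivity) hm hδ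
    hδ' (fun _ hs => volume_div_lt_maximalIndicator_le hn hEm ht hE hs) hF

theorem maximalIndicator_le_add (E S : Set (Fin n → ℝ)) (x : Fin n → ℝ) :
    maximalIndicator E x ≤ maximalIndicator (E ∩ S) x + maximalIndicator (E \ S) x := by
  refine iSup₂_le fun c r => iSup₂_le fun hr hx => ?_
  calc volume (E ∩ ball c r) / volume (ball c r)
      ≤ (volume (E ∩ S ∩ ball c r) + volume (E \ S ∩ ball c r)) / volume (ball c r) := by
        gcongr
        refine (measure_mono ?_).trans (measure_union_le _ _)
        rw [← union_inter_distrib_right, inter_union_sdiff]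
    _ = _ := ENNReal.add_div
    _ ≤ _ := add_le_add (div_le_maximalIndicator _ hr hx) (div_le_maximalIndicator _ hr hx)

/-- Away from the tripled ball, the maximal function is essentially constant on the ball. -/
theorem maximalIndicator_diff_le (E : Set (Fin n → ℝ)) {c x y : Fin n → ℝ} {r : ℝ}
    (hx : x ∈ closedBall c r) (hy : y ∈ closedBall c r) :
    maximalIndicator (E \ ball c (3 * r)) y ≤ ENNReal.ofReal (3 ^ n) * maximalIndicator E x := by
  refine iSup₂_le fun c' r' => iSup₂_le fun hr' hy' => ?_
  by_cases hemp : E \ ball c (3 * r) ∩ ball c' r' = ∅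
  · simp [hemp]
  obtain ⟨z, ⟨_, hz⟩, hz'⟩ := nonempty_iff_ne_empty.2 hemp
  rw [mem_closedBall] at hx hy
  rw [mem_ball] at hy' hz hz'
  -- A ball that contains a point of the small ball and reaches outside the tripled one has radius
  -- larger than `r`; its own triple then contains `x`.
  have hrr : r < r' := by
    have h1 := dist_triangle z y c
    have h2 := dist_triangle z c' y
    rw [dist_comm c' y] at h2
    linarith [not_lt.1 hz]
  have hx' : x ∈ ball c' (3 * r') := by
    rw [mem_ball]
    have h1 := dist_triangle x c c'
    have h2 := dist_triangle c y c'
    rw [dist_comm c y] at h2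
    linarith
  have h3r : 0 < 3 * r' := by linarith
  rw [ENNReal.div_le_iff (volume_ball_ne_zero hr') volume_ball_ne_top]
  calc volume (E \ ball c (3 * r) ∩ ball c' r')
      ≤ volume (E ∩ ball c' (3 * r')) :=
        measure_mono (inter_subset_inter sdiff_subset (ball_subset_ball (by linarith)))
    _ ≤ maximalIndicator E x * volume (ball c' (3 * r')) := volume_inter_ball_le E h3r hx'
    _ = _ := by
        rw [volume_ball_mul _ hr' (by norm_num)]
        ring

/-- Powers of the maximal function are `A₁` weights, with the sharp dependence on the power. -/
theorem setLIntegral_closedBall_maximalIndicator_rpow_le (hn : 1 ≤ n) {E : Set (Fin n → ℝ)}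
    (hEm : MeasurableSet E) {δ : ℝ} (hδ : 0 < δ) (hδ' : δ ≤ 1) {c x : Fin n → ℝ} {r : ℝ}
    (hr : 0 < r) (hx : x ∈ closedBall c r) :
    ∫⁻ y in closedBall c r, maximalIndicator E y ^ (1 - δ) ≤
      ENNReal.ofReal (2 * 12 ^ n / δ) * volume (closedBall c r) *
        maximalIndicator E x ^ (1 - δ) := by
  set M := maximalIndicator E x with hM
  have hMtop : M ≠ ∞ := ((maximalIndicator_le_one E x).trans_lt ENNReal.one_lt_top).ne
  set m : ℝ := (2 * r) ^ n with hm
  have hm0 : 0 < m := by positivity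
  have hq : 0 ≤ 1 - δ := by linarith
  have hvol : volume (closedBall c r) = ENNReal.ofReal m := by
    rw [Real.volume_pi_closedBall _ hr.le, Fintype.card_fin]
  have hpow : ∀ k : ℝ, 1 ≤ k → ENNReal.ofReal k ^ (1 - δ) ≤ ENNReal.ofReal k := fun k hk => by
    rw [ENNReal.ofReal_rpow_of_nonneg (by linarith) hq]
    refine ENNReal.ofReal_le_ofReal ?_
    simpa using Real.rpow_le_rpow_of_exponent_le hk (by linarith : 1 - δ ≤ 1)
  have hsmall : volume (E ∩ ball c (3 * r)) ≤ ENNReal.ofReal (3 ^ n * m * M.toReal) := by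
    refine (volume_inter_ball_le E (by linarith) (closedBall_subset_ball (by linarith) hx)).trans ?_
    rw [volume_ball_mul _ hr (by norm_num), ← volume_closedBall_eq _ hr, hvol,
      ENNReal.ofReal_mul (by positivity), ENNReal.ofReal_mul (by positivity),
      ENNReal.ofReal_toReal hMtop, mul_comm]
  have hsmall_top : volume (E ∩ ball c (3 * r)) ≠ ∞ :=
    (hsmall.trans_lt ENNReal.ofReal_lt_top).ne
  -- Kolmogorov's inequality for the local part of `E`, whose measure is at most `3^n |B| M(x)`. The
  -- powers `m^{1-δ}` and `m^δ` recombine to `|B|`, and `12 = 4 * 3`.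
  have hnear : ∫⁻ y in closedBall c r, maximalIndicator (E ∩ ball c (3 * r)) y ^ (1 - δ) ≤
      ENNReal.ofReal (12 ^ n / δ) * ENNReal.ofReal m * M ^ (1 - δ) := by
    refine (setLIntegral_maximalIndicator_rpow_le hn (hEm.inter measurableSet_ball)
      ENNReal.toReal_nonneg (ENNReal.ofReal_toReal hsmall_top).symm hδ hδ' hm0.le hvol.le).trans ?_
    have h1 : (volume (E ∩ ball c (3 * r))).toReal ≤ 3 ^ n * m * M.toReal :=
      ENNReal.toReal_le_of_le_ofReal (by positivity) hsmall
    calc ENNReal.ofReal ((4 ^ n * (volume (E ∩ ball c (3 * r))).toReal) ^ (1 - δ) * (m ^ δ / δ))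
        ≤ ENNReal.ofReal ((4 ^ n * (3 ^ n * m * M.toReal)) ^ (1 - δ) * (m ^ δ / δ)) := by
          gcongr
      _ = ENNReal.ofReal (((12 : ℝ) ^ n) ^ (1 - δ) * (m / δ) * M.toReal ^ (1 - δ)) := by
          congr 1
          rw [show (4 : ℝ) ^ n * (3 ^ n * m * M.toReal) = 12 ^ n * m * M.toReal by
            rw [show (12 : ℝ) = 4 * 3 by norm_num, mul_pow]; ring,
            Real.mul_rpow (by positivity) (by positivity),
            Real.mul_rpow (by positivity) (by positivity)]
          have : m ^ (1 - δ) * m ^ δ = m := by rw [← Real.rpow_add hm0]; simp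
          calc _ = ((12 : ℝ) ^ n) ^ (1 - δ) * ((m ^ (1 - δ) * m ^ δ) / δ) * M.toReal ^ (1 - δ) := by
                ring
            _ = _ := by rw [this]
      _ ≤ ENNReal.ofReal ((12 : ℝ) ^ n * (m / δ) * M.toReal ^ (1 - δ)) := by
          gcongr
          have := Real.rpow_le_rpow_of_exponent_le (one_le_pow₀ (by norm_num) : (1 : ℝ) ≤ 12 ^ n)
            (by linarith : 1 - δ ≤ 1)
          simpa using this
      _ = _ := by
          rw [← ENNReal.ofReal_toReal hMtop, ENNReal.ofReal_rpow_of_nonneg (by simp) hq,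
            ← ENNReal.ofReal_mul (by positivity), ← ENNReal.ofReal_mul (by positivity),
            ENNReal.toReal_ofReal (by simp)]
          congr 1
          ring
  have hfar : ∫⁻ y in closedBall c r, maximalIndicator (E \ ball c (3 * r)) y ^ (1 - δ) ≤
      ENNReal.ofReal (12 ^ n / δ) * ENNReal.ofReal m * M ^ (1 - δ) := by
    calc _ ≤ ∫⁻ y in closedBall c r, ENNReal.ofReal (12 ^ n / δ) * M ^ (1 - δ) := by
          refine setLIntegral_mono' measurableSet_closedBall fun y hy => ?_
          calc _ ≤ (ENNReal.ofReal (3 ^ n) * M) ^ (1 - δ) :=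
                ENNReal.rpow_le_rpow (maximalIndicator_diff_le E hx hy) hq
            _ = ENNReal.ofReal (3 ^ n) ^ (1 - δ) * M ^ (1 - δ) := ENNReal.mul_rpow_of_nonneg _ _ hq
            _ ≤ _ := by
              gcongr
              refine (hpow _ (one_le_pow₀ (by norm_num))).trans (ENNReal.ofReal_le_ofReal ?_)
              calc (3 : ℝ) ^ n ≤ 12 ^ n := by gcongr; norm_num
                _ ≤ 12 ^ n / δ := le_div_self (by positivity) hδ hδ'
      _ = _ := by rw [setLIntegral_const, hvol]; ring
  calc ∫⁻ y in closedBall c r, maximalIndicator E y ^ (1 - δ)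
      ≤ ∫⁻ y in closedBall c r, (maximalIndicator (E ∩ ball c (3 * r)) y ^ (1 - δ) +
          maximalIndicator (E \ ball c (3 * r)) y ^ (1 - δ)) := by
        refine lintegral_mono fun y => ?_
        exact (ENNReal.rpow_le_rpow (maximalIndicator_le_add E (ball c (3 * r)) y) hq).trans
          (ENNReal.rpow_add_le_add_rpow _ _ hq (by linarith))
    _ = _ := lintegral_add_left ((measurable_maximalIndicator _).pow_const _) _
    _ ≤ _ := add_le_add hnear hfar
    _ = _ := by
        rw [hvol, ← two_mul, ← mul_assoc, ← mul_assoc, mul_div_assoc,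
          ENNReal.ofReal_mul (by norm_num : (0 : ℝ) ≤ 2), ENNReal.ofReal_ofNat]

end Maximal

/-! ### The test weight: its `A_p` constant and its mass -/

section Weight

open Metric

variable {n : ℕ}

theorem cube_eq_closedBall (a : Fin n → ℝ) {r : ℝ} (hr : 0 < r) :
    cube a r = closedBall (fun i => a i + r / 2) (r / 2) := by
  rw [closedBall_pi _ (by positivity), cube, ← pi_univ_Icc]
  congr 1
  ext i : 1
  rw [Real.closedBall_eq_Icc]
  congr 1 <;> ring

theorem volume_cube_ne_zero (a : Fin n → ℝ) {r : ℝ} (hr : 0 < r) : volume (cube a r) ≠ 0 := by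
  rw [cube_eq_closedBall a hr]
  exact (measure_closedBall_pos volume _ (by positivity)).ne'

theorem volume_cube_ne_top (a : Fin n → ℝ) (r : ℝ) : volume (cube a r) ≠ ∞ :=
  isCompact_Icc.measure_lt_top.ne

theorem measurableSet_cube (a : Fin n → ℝ) (r : ℝ) : MeasurableSet (cube a r) :=
  measurableSet_Icc

/-- An `A₁` weight is an `A_p` weight, with no larger constant. -/
theorem muckenhouptConst_le_of_setLAverage_le {p : ℝ} (hp : 1 < p) {u : (Fin n → ℝ) → ℝ≥0∞}
    (hfin : ∀ x, u x ≠ ∞) {A : ℝ≥0∞} (hA : A ≠ ∞)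
    (h : ∀ a r, 0 < r → ∀ x ∈ cube a r, ⨍⁻ y in cube a r, u y ∂volume ≤ A * u x) :
    muckenhouptConst p u ≤ A := by
  have hp1 : 0 < p - 1 := by linarith
  refine iSup₂_le fun a r => iSup_le fun hr => ?_
  set I := ⨍⁻ y in cube a r, u y ∂volume with hI
  have hne : (cube a r).Nonempty := nonempty_of_measure_ne_zero (volume_cube_ne_zero a hr)
  obtain ⟨x₀, hx₀⟩ := hne
  by_cases hI0 : I = 0
  · simp [hI0]
  have hItop : I ≠ ∞ := ((h a r hr x₀ hx₀).trans_lt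
    (ENNReal.mul_lt_top hA.lt_top (hfin x₀).lt_top)).ne
  have hA0 : A ≠ 0 := by
    rintro rfl
    exact hI0 (le_antisymm (by simpa using h a r hr x₀ hx₀) bot_le)
  -- The hypothesis says `u ≥ I / A` throughout the cube, and the exponent is negative.
  have hdual : ⨍⁻ x in cube a r, (u x) ^ (-(1 / (p - 1))) ∂volume ≤ (I / A) ^ (-(1 / (p - 1))) := by
    rw [setLAverage_eq]
    refine ENNReal.div_le_of_le_mul ?_
    rw [← setLIntegral_const]
    refine setLIntegral_mono' (measurableSet_cube a r) fun x hx => ?_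
    rw [ENNReal.rpow_neg, ENNReal.rpow_neg]
    gcongr
    rw [ENNReal.div_le_iff hA0 hA, mul_comm]
    exact h a r hr x hx
  calc I * (⨍⁻ x in cube a r, (u x) ^ (-(1 / (p - 1))) ∂volume) ^ (p - 1)
      ≤ I * ((I / A) ^ (-(1 / (p - 1)))) ^ (p - 1) := by gcongr
    _ = I * (A / I) := by
        rw [← ENNReal.rpow_mul, show -(1 / (p - 1)) * (p - 1) = -1 by field_simp,
          ENNReal.rpow_neg_one, ENNReal.inv_div (Or.inl hA) (Or.inl hA0)]
    _ = A := ENNReal.mul_div_cancel hI0 hItop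

/-- Hölder's inequality for `1 = u^{1/p} u^{-1/p}` on the unit cube. It is needed because `φ` is
controlled only on `[1, ∞)`. -/
theorem one_le_muckenhouptConst {p : ℝ} (hp : 1 < p) {u : (Fin n → ℝ) → ℝ≥0∞}
    (hu : Measurable u) (hpos : ∀ x, 0 < u x) (hfin : ∀ x, u x ≠ ∞) :
    1 ≤ muckenhouptConst p u := by
  have hp0 : 0 < p := by linarith
  have hp1 : 0 < p - 1 := by linarith
  refine le_trans ?_ (le_iSup₂_of_le (0 : Fin n → ℝ) (1 : ℝ) (le_iSup_of_le one_pos le_rfl))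
  set Q := cube (0 : Fin n → ℝ) 1
  have hV0 : volume Q ≠ 0 := volume_cube_ne_zero _ one_pos
  have hVt : volume Q ≠ ∞ := volume_cube_ne_top _ _
  have hV : volume Q = 1 := by
    simp only [Q, cube_eq_closedBall (0 : Fin n → ℝ) one_pos]
    rw [Real.volume_pi_closedBall _ (by norm_num)]
    norm_num
  rw [setLAverage_eq, setLAverage_eq, hV, div_one, div_one]
  set I := ∫⁻ x in Q, u x
  set J := ∫⁻ x in Q, u x ^ (-(1 / (p - 1)))
  have hpq := Real.HolderConjugate.conjExponent hp
  have hq : p.conjExponent = p / (p - 1) := rfl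
  have hH := ENNReal.lintegral_mul_le_Lp_mul_Lq (volume.restrict Q) hpq
    (f := fun x => u x ^ (1 / p)) (g := fun x => u x ^ (-(1 / p)))
    (hu.pow_const _).aemeasurable (hu.pow_const _).aemeasurable
  have h1 : ∫⁻ x in Q, ((fun x => u x ^ (1 / p)) * fun x => u x ^ (-(1 / p))) x = 1 := by
    calc _ = ∫⁻ _ in Q, 1 := by
          refine lintegral_congr fun x => ?_
          rw [Pi.mul_apply, ← ENNReal.rpow_add _ _ (hpos x).ne' (hfin x)]
          simp
      _ = 1 := by simp [hV]
  have h2 : ∀ x, (u x ^ (1 / p)) ^ p = u x := fun x => by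
    rw [← ENNReal.rpow_mul, one_div_mul_cancel hp0.ne', ENNReal.rpow_one]
  have h3 : ∀ x, (u x ^ (-(1 / p))) ^ p.conjExponent = u x ^ (-(1 / (p - 1))) := fun x => by
    rw [← ENNReal.rpow_mul, hq]
    congr 1
    field_simp
  simp only [h1, h2, h3] at hH
  have h4 := ENNReal.rpow_le_rpow hH hp0.le
  rw [ENNReal.one_rpow, ENNReal.mul_rpow_of_nonneg _ _ hp0.le, ← ENNReal.rpow_mul,
    ← ENNReal.rpow_mul, one_div_mul_cancel hp0.ne', ENNReal.rpow_one, hq,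
    show 1 / (p / (p - 1)) * p = p - 1 by field_simp] at h4
  exact h4

/-- The weight `1_E + δ (M 1_E)^{1-δ}`. -/
def testWeight (E : Set (Fin n → ℝ)) (δ : ℝ) (x : Fin n → ℝ) : ℝ≥0∞ :=
  E.indicator 1 x + ENNReal.ofReal δ * maximalIndicator E x ^ (1 - δ)

variable {E : Set (Fin n → ℝ)} {δ : ℝ}

theorem measurable_testWeight (hE : MeasurableSet E) : Measurable (testWeight E δ) :=
  (measurable_one.indicator hE).add
    (((measurable_maximalIndicator E).pow_const _).const_mul _)

theorem one_le_testWeight {x : Fin n → ℝ} (hx : x ∈ E) : 1 ≤ testWeight E δ x := by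
  simp [testWeight, indicator_of_mem hx]

theorem maximalIndicator_ne_top (E : Set (Fin n → ℝ)) (x : Fin n → ℝ) :
    maximalIndicator E x ≠ ∞ :=
  ((maximalIndicator_le_one E x).trans_lt ENNReal.one_lt_top).ne

theorem testWeight_pos (hE : volume E ≠ 0) (hδ : 0 < δ) (x : Fin n → ℝ) :
    0 < testWeight E δ x := by
  refine lt_of_lt_of_le ?_ le_add_self
  exact ENNReal.mul_pos (ENNReal.ofReal_pos.2 hδ).ne'
    (ENNReal.rpow_pos (maximalIndicator_pos hE x) (maximalIndicator_ne_top E x)).ne'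

theorem testWeight_le_two (hδ' : δ ≤ 1) (x : Fin n → ℝ) :
    testWeight E δ x ≤ 2 := by
  rw [← one_add_one_eq_two]
  refine add_le_add (indicator_apply_le fun _ => le_rfl) ?_
  refine mul_le_one' (by simpa using hδ') ?_
  exact ENNReal.rpow_le_one (maximalIndicator_le_one E x) (by linarith)

/-- Both summands have averages at most a constant times `M^{1-δ}` at `x`: the indicator because `M
≤ M^{1-δ}`, the other because the prefactor `δ` cancels the `1/δ` of the `A₁` bound. The factor
`1/δ` is paid once, in `M^{1-δ} ≤ u / δ`. -/
theorem setLIntegral_testWeight_le (hn : 1 ≤ n) (hE : MeasurableSet E) (hδ : 0 < δ) (hδ' : δ ≤ 1)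
    {c x : Fin n → ℝ} {r : ℝ} (hr : 0 < r) (hx : x ∈ closedBall c r) :
    ∫⁻ y in closedBall c r, testWeight E δ y ≤
      ENNReal.ofReal (3 * 12 ^ n / δ) * testWeight E δ x * volume (closedBall c r) := by
  set M := maximalIndicator E x
  set V := volume (closedBall c r) with hV
  have hMq : M ≤ M ^ (1 - δ) := by
    simpa using ENNReal.rpow_le_rpow_of_exponent_ge (maximalIndicator_le_one E x)
      (by linarith : 1 - δ ≤ 1)
  have hMu : M ^ (1 - δ) ≤ ENNReal.ofReal (1 / δ) * testWeight E δ x := by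
    calc M ^ (1 - δ) = ENNReal.ofReal (1 / δ) * (ENNReal.ofReal δ * M ^ (1 - δ)) := by
          rw [← mul_assoc, ← ENNReal.ofReal_mul (by positivity), one_div_mul_cancel hδ.ne',
            ENNReal.ofReal_one, one_mul]
      _ ≤ _ := by gcongr; exact le_add_self
  have h1 : ∫⁻ y in closedBall c r, E.indicator 1 y ≤ ENNReal.ofReal (12 ^ n) * V * M ^ (1 - δ) := by
    rw [lintegral_indicator_one hE, Measure.restrict_apply hE]
    calc volume (E ∩ closedBall c r) ≤ volume (E ∩ ball c (2 * r)) :=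
          measure_mono (inter_subset_inter_right _ (closedBall_subset_ball (by linarith)))
      _ ≤ M * volume (ball c (2 * r)) :=
          volume_inter_ball_le E (by linarith) (closedBall_subset_ball (by linarith) hx)
      _ = M * (ENNReal.ofReal (2 ^ n) * V) := by
          rw [volume_ball_mul c hr (by norm_num), hV, volume_closedBall_eq c hr]
      _ ≤ M ^ (1 - δ) * (ENNReal.ofReal (12 ^ n) * V) := by
          gcongr
          norm_num
      _ = _ := mul_comm _ _
  have h2 : ∫⁻ y in closedBall c r, ENNReal.ofReal δ * maximalIndicator E y ^ (1 - δ) ≤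
      ENNReal.ofReal (2 * 12 ^ n) * V * M ^ (1 - δ) := by
    rw [lintegral_const_mul _ ((measurable_maximalIndicator E).pow_const _)]
    calc _ ≤ ENNReal.ofReal δ * (ENNReal.ofReal (2 * 12 ^ n / δ) * V * M ^ (1 - δ)) := by
          gcongr
          exact setLIntegral_closedBall_maximalIndicator_rpow_le hn hE hδ hδ' hr hx
      _ = _ := by
          rw [← mul_assoc, ← mul_assoc, ← ENNReal.ofReal_mul hδ.le, mul_div_cancel₀ _ hδ.ne']
  calc ∫⁻ y in closedBall c r, testWeight E δ y
      = (∫⁻ y in closedBall c r, E.indicator 1 y) +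
        ∫⁻ y in closedBall c r, ENNReal.ofReal δ * maximalIndicator E y ^ (1 - δ) :=
        lintegral_add_left (measurable_one.indicator hE) _
    _ ≤ ENNReal.ofReal (12 ^ n) * V * M ^ (1 - δ) +
        ENNReal.ofReal (2 * 12 ^ n) * V * M ^ (1 - δ) := add_le_add h1 h2
    _ = ENNReal.ofReal (3 * 12 ^ n) * V * M ^ (1 - δ) := by
        rw [← add_mul, ← add_mul, ← ENNReal.ofReal_add (by positivity) (by positivity)]
        congr 3
        ring
    _ ≤ ENNReal.ofReal (3 * 12 ^ n) * V * (ENNReal.ofReal (1 / δ) * testWeight E δ x) := by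
        gcongr
    _ = _ := by
        have h3 : ENNReal.ofReal (3 * 12 ^ n / δ) =
            ENNReal.ofReal (3 * 12 ^ n) * ENNReal.ofReal (1 / δ) := by
          rw [← ENNReal.ofReal_mul (by positivity), mul_one_div]
        rw [h3]
        ring

theorem muckenhouptConst_testWeight_le (hn : 1 ≤ n) (hE : MeasurableSet E)
    (hδ : 0 < δ) (hδ' : δ ≤ 1) {p : ℝ} (hp : 1 < p) :
    muckenhouptConst p (testWeight E δ) ≤ ENNReal.ofReal (3 * 12 ^ n / δ) := by
  refine muckenhouptConst_le_of_setLAverage_le hp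
    (fun x => ((testWeight_le_two hδ' x).trans_lt (by simp)).ne) ENNReal.ofReal_ne_top
    fun a r hr x hx => ?_
  rw [setLAverage_eq]
  refine ENNReal.div_le_of_le_mul ?_
  rw [cube_eq_closedBall a hr] at hx ⊢
  exact setLIntegral_testWeight_le hn hE hδ hδ' (by positivity) hx

theorem isMuckenhoupt_testWeight (hn : 1 ≤ n) (hE : MeasurableSet E) (hE0 : volume E ≠ 0)
    (hδ : 0 < δ) (hδ' : δ ≤ 1) {p : ℝ} (hp : 1 < p) : IsMuckenhoupt p (testWeight E δ) where
  measurable := measurable_testWeight hE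
  pos := ae_of_all _ (testWeight_pos hE0 hδ)
  finite := ae_of_all _ fun x => (testWeight_le_two hδ' x).trans_lt (by simp)
  locallyIntegrable a r := by
    refine (lintegral_mono fun x => testWeight_le_two hδ' x).trans_lt ?_
    rw [setLIntegral_const]
    exact ENNReal.mul_lt_top (by simp) (volume_cube_ne_top a r).lt_top
  const_lt_top :=
    (muckenhouptConst_testWeight_le hn hE hδ hδ' hp).trans_lt ENNReal.ofReal_lt_top

theorem muckenhouptConst_testWeight_toReal_mem (hn : 1 ≤ n) (hE : MeasurableSet E)
    (hE0 : volume E ≠ 0) (hδ : 0 < δ) (hδ' : δ ≤ 1) {p : ℝ} (hp : 1 < p) :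
    (muckenhouptConst p (testWeight E δ)).toReal ∈ Icc 1 (3 * 12 ^ n / δ) := by
  have hle := muckenhouptConst_testWeight_le hn hE hδ hδ' hp
  refine ⟨?_, ENNReal.toReal_le_of_le_ofReal (by positivity) hle⟩
  have h1 := one_le_muckenhouptConst hp (measurable_testWeight (δ := δ) hE) (testWeight_pos hE0 hδ)
    fun x => ((testWeight_le_two hδ' x).trans_lt (by simp)).ne
  simpa using ENNReal.toReal_mono (hle.trans_lt ENNReal.ofReal_lt_top).ne h1

/-- Sets of measure at most `e^{1/δ - 1} |E|` have weighted measure comparable to `|E|`. -/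
theorem weighted_testWeight_le (hn : 1 ≤ n) (hE : MeasurableSet E) {t : ℝ} (ht : 0 < t)
    (hEt : volume E = ENNReal.ofReal t) (hδ : 0 < δ) (hδ' : δ ≤ 1) {F : Set (Fin n → ℝ)}
    (hF : volume F ≤ ENNReal.ofReal (t * Real.exp (1 / δ - 1))) :
    weighted (testWeight E δ) F ≤ ENNReal.ofReal ((1 + 4 ^ n * 3) * t) := by
  set m := t * Real.exp (1 / δ - 1) with hm
  have hm0 : 0 < m := by positivity
  rw [weighted, withDensity_apply' _ F]
  have hpow : ((4 : ℝ) ^ n * t) ^ (1 - δ) * m ^ δ ≤ 4 ^ n * 3 * t := by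
    rw [hm, Real.mul_rpow (by positivity) ht.le, Real.mul_rpow ht.le (Real.exp_pos _).le,
      ← Real.exp_mul]
    have h1 : t ^ (1 - δ) * t ^ δ = t := by rw [← Real.rpow_add ht]; simp
    have h2 : ((4 : ℝ) ^ n) ^ (1 - δ) ≤ 4 ^ n := by
      simpa using Real.rpow_le_rpow_of_exponent_le (one_le_pow₀ (by norm_num) : (1 : ℝ) ≤ 4 ^ n)
        (by linarith : 1 - δ ≤ 1)
    -- Raising the exponential size of `F` to the power `δ` leaves `e^{1-δ} ≤ e`; this dictates the
    -- admissible size of `F`.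
    have h3 : Real.exp ((1 / δ - 1) * δ) ≤ 3 := by
      have : (1 / δ - 1) * δ = 1 - δ := by field_simp
      rw [this]
      exact (Real.exp_le_exp.2 (by linarith)).trans (Real.exp_one_lt_d9.le.trans (by norm_num))
    calc _ = ((4 : ℝ) ^ n) ^ (1 - δ) * Real.exp ((1 / δ - 1) * δ) * (t ^ (1 - δ) * t ^ δ) := by ring
      _ ≤ _ := by rw [h1]; gcongr
  calc ∫⁻ x in F, testWeight E δ x
      = (∫⁻ x in F, E.indicator 1 x) +
        ∫⁻ x in F, ENNReal.ofReal δ * maximalIndicator E x ^ (1 - δ) :=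
        lintegral_add_left (measurable_one.indicator hE) _
    _ ≤ ENNReal.ofReal t +
        ENNReal.ofReal δ * ENNReal.ofReal ((4 ^ n * t) ^ (1 - δ) * (m ^ δ / δ)) := by
        refine add_le_add ?_ ?_
        · rw [lintegral_indicator_one hE, ← hEt]
          exact Measure.restrict_apply_le _ _
        · rw [lintegral_const_mul _ ((measurable_maximalIndicator E).pow_const _)]
          gcongr
          exact setLIntegral_maximalIndicator_rpow_le hn hE ht.le hEt hδ hδ' hm0.le hF
    _ = ENNReal.ofReal (t + (4 ^ n * t) ^ (1 - δ) * m ^ δ) := by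
        rw [← ENNReal.ofReal_mul hδ.le, ← ENNReal.ofReal_add ht.le (by positivity)]
        congr 2
        field_simp
    _ ≤ _ := ENNReal.ofReal_le_ofReal (by linarith)

end Weight

/-! ### Growth of `φ` and discretisation of the Hardy and Calderón terms -/

section Admissible

variable {φ : ℝ → ℝ}

theorem IsAdmissible.pos (hφ : IsAdmissible φ) {x : ℝ} (hx : 1 ≤ x) : 0 < φ x :=
  one_pos.trans_le (hφ.one_le x hx)

theorem IsAdmissible.hasDerivAt (hφ : IsAdmissible φ) {x : ℝ} (hx : 1 < x) :
    HasDerivAt φ (derivWithin φ (Ici 1) x) x :=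
  ((hφ.differentiable x hx.le).hasDerivWithinAt).hasDerivAt (Ici_mem_nhds hx)

theorem IsAdmissible.monotoneOn (hφ : IsAdmissible φ) : MonotoneOn φ (Ici 1) := by
  obtain ⟨γ, β, hγ, hβ, h⟩ := hφ.logDeriv_bounds
  refine monotoneOn_of_deriv_nonneg (convex_Ici 1) hφ.differentiable.continuousOn
    (hφ.differentiable.mono interior_subset) fun x hx => ?_
  rw [interior_Ici, mem_Ioi] at hx
  rw [(hφ.hasDerivAt hx).deriv]
  have h1 : 0 < derivWithin φ (Ici 1) x / φ x :=
    lt_of_lt_of_le (div_pos hγ (by linarith)) (h x hx.le).1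
  exact ((div_pos_iff_of_pos_right (hφ.pos hx.le)).1 h1).le

/-- The upper bound on the logarithmic derivative makes `φ(y) y^{-β}` nonincreasing. Dimensional
constants inside `φ` can thus be pulled out. -/
theorem IsAdmissible.exists_le_rpow_mul (hφ : IsAdmissible φ) :
    ∃ β : ℝ, 0 < β ∧ ∀ A x : ℝ, 1 ≤ A → 1 ≤ x → φ (A * x) ≤ A ^ β * φ x := by
  obtain ⟨γ, β, hγ, hβ, h⟩ := hφ.logDeriv_bounds
  refine ⟨β, hβ, fun A x hA hx => ?_⟩
  have hanti : AntitoneOn (fun y => φ y * y ^ (-β)) (Ici 1) := by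
    have hder : ∀ y : ℝ, 1 < y → HasDerivAt (fun y => φ y * y ^ (-β))
        (derivWithin φ (Ici 1) y * y ^ (-β) + φ y * (-β * y ^ (-β - 1))) y := fun y hy =>
      (hφ.hasDerivAt hy).mul (Real.hasDerivAt_rpow_const (Or.inl (by linarith)))
    refine antitoneOn_of_deriv_nonpos (convex_Ici 1) ?_ ?_ fun y hy => ?_
    · refine hφ.differentiable.continuousOn.mul
        (continuousOn_id.rpow_const fun y hy => Or.inl ?_)
      have : (1 : ℝ) ≤ y := hy
      simp only [id]
      linarith
    · intro y hy
      rw [interior_Ici, mem_Ioi] at hy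
      exact (hder y hy).differentiableAt.differentiableWithinAt
    · rw [interior_Ici, mem_Ioi] at hy
      rw [(hder y hy).deriv]
      have hy0 : 0 < y := by linarith
      have h2 := (h y hy.le).2
      rw [div_le_iff₀ (hφ.pos hy.le)] at h2
      rw [Real.rpow_sub_one hy0.ne']
      have h3 : 0 < y ^ (-β) := Real.rpow_pos_of_pos hy0 _
      calc derivWithin φ (Ici 1) y * y ^ (-β) + φ y * (-β * (y ^ (-β) / y))
          ≤ β / y * φ y * y ^ (-β) + φ y * (-β * (y ^ (-β) / y)) := by gcongr
        _ = 0 := by ring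
  have hx0 : 0 < x := by linarith
  have hA0 : 0 < A := by linarith
  have hAx : x ≤ A * x := le_mul_of_one_le_left hx0.le hA
  have h1 := hanti (mem_Ici.2 hx) (mem_Ici.2 (hx.trans hAx)) hAx
  simp only at h1
  rw [Real.mul_rpow hA0.le hx0.le, Real.rpow_neg hA0.le, Real.rpow_neg hx0.le,
    ← mul_assoc] at h1
  have h2 := le_of_mul_le_mul_right h1 (inv_pos.2 (Real.rpow_pos_of_pos hx0 β))
  rw [mul_inv_le_iff₀ (Real.rpow_pos_of_pos hA0 β)] at h2
  linarith

/-- The points `t e^{2^k - 1}`, at which `1 + log (s / t) = 2 ^ k`. -/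
def scale (t : ℝ) (k : ℕ) : ℝ := t * Real.exp (2 ^ k - 1)

theorem scale_zero (t : ℝ) : scale t 0 = t := by simp [scale]

theorem scale_pos {t : ℝ} (ht : 0 < t) (k : ℕ) : 0 < scale t k := mul_pos ht (Real.exp_pos _)

theorem scale_monotone {t : ℝ} (ht : 0 < t) : Monotone (scale t) := fun i j hij => by
  unfold scale
  gcongr
  norm_num

theorem one_add_log_scale_div {t : ℝ} (ht : 0 < t) (k : ℕ) :
    1 + Real.log (scale t k / t) = 2 ^ k := by
  rw [scale, mul_div_cancel_left₀ _ ht.ne', Real.log_exp]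
  ring

theorem lintegral_Ioo_inv {a b : ℝ} (ha : 0 < a) (hab : a ≤ b) :
    ∫⁻ s in Ioo a b, ENNReal.ofReal (1 / s) = ENNReal.ofReal (Real.log (b / a)) := by
  have h0 : (0 : ℝ) ∉ uIcc a b := by
    rw [uIcc_of_le hab]
    exact fun h => absurd h.1 (not_le.2 ha)
  have hint : IntervalIntegrable (fun s : ℝ => 1 / s) volume a b :=
    intervalIntegral.intervalIntegrable_one_div (fun x hx => ne_of_mem_of_not_mem hx h0)
      continuousOn_id
  rw [restrict_Ioo_eq_restrict_Ioc, ← ofReal_integral_eq_lintegral_ofReal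
    ((intervalIntegrable_iff_integrableOn_Ioc_of_le hab).1 hint)]
  · rw [← intervalIntegral.integral_of_le hab, integral_one_div h0]
  · filter_upwards [ae_restrict_mem measurableSet_Ioc] with s hs
    exact one_div_nonneg.2 (ha.trans hs.1).le

/-- Between consecutive scales `1 + log(s/t)` lies in `[2^k, 2^{k+1}]`, and the interval has
`ds/s`-length `2^k`. Length times the kernel factor `2^{-(k+1)}` is `1/2`, whence the `2`. -/
theorem mul_scale_le_setLIntegral (hφ : IsAdmissible φ) {h : ℝ → ℝ≥0∞} (hh : Antitone h) {t : ℝ}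
    (ht : 0 < t) (k : ℕ) :
    ENNReal.ofReal (φ (2 ^ k)) * h (scale t (k + 1)) ≤
      2 * ∫⁻ s in Ioo (scale t k) (scale t (k + 1)),
        ENNReal.ofReal ((1 + Real.log (s / t))⁻¹ * φ (1 + Real.log (s / t))) * h s *
          ENNReal.ofReal (1 / s) := by
  have hk : (1 : ℝ) ≤ 2 ^ k := one_le_pow₀ (by norm_num)
  have hφk : 0 < φ (2 ^ k) := hφ.pos hk
  have hlog : Real.log (scale t (k + 1) / scale t k) = 2 ^ k := by
    rw [scale, scale, mul_div_mul_left _ _ ht.ne', ← Real.exp_sub, Real.log_exp]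
    ring
  calc ENNReal.ofReal (φ (2 ^ k)) * h (scale t (k + 1))
      = 2 * ∫⁻ s in Ioo (scale t k) (scale t (k + 1)),
        ENNReal.ofReal ((2 ^ (k + 1))⁻¹ * φ (2 ^ k)) * h (scale t (k + 1)) *
          ENNReal.ofReal (1 / s) := by
        rw [lintegral_const_mul _ (by fun_prop),
          lintegral_Ioo_inv (scale_pos ht k) (scale_monotone ht k.le_succ), hlog,
          mul_right_comm (ENNReal.ofReal _), ← ENNReal.ofReal_mul (by positivity), ← mul_assoc,
          ← ENNReal.ofReal_ofNat 2, ← ENNReal.ofReal_mul (by norm_num)]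
        congr 2
        field_simp
        ring
    _ ≤ _ := by
        gcongr 2 * ?_
        refine setLIntegral_mono' measurableSet_Ioo fun s hs => ?_
        have hs0 : 0 < s := (scale_pos ht k).trans hs.1
        have h1 : 2 ^ k ≤ 1 + Real.log (s / t) := by
          rw [← one_add_log_scale_div ht k]
          have := scale_pos ht k
          gcongr
          exact hs.1.le
        have h2 : 1 + Real.log (s / t) ≤ 2 ^ (k + 1) := by
          rw [← one_add_log_scale_div ht (k + 1)]
          gcongr
          exact hs.2.le
        have h3 : φ (2 ^ k) ≤ φ (1 + Real.log (s / t)) :=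
          hφ.monotoneOn (mem_Ici.2 hk) (mem_Ici.2 (hk.trans h1)) h1
        have h4 : 0 < 1 + Real.log (s / t) := by linarith
        gcongr
        exact hh hs.2.le

theorem tsum_mul_scale_le_calderonQ (hφ : IsAdmissible φ) {h : ℝ → ℝ≥0∞} (hh : Antitone h) {t : ℝ}
    (ht : 0 < t) :
    ∑' k : ℕ, ENNReal.ofReal (φ (2 ^ k)) * h (scale t (k + 1)) ≤ 2 * calderonQ φ h t := by
  have hdisj : Pairwise (Function.onFun Disjoint fun k : ℕ => Ioo (scale t k) (scale t (k + 1))) :=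
    (scale_monotone ht).pairwise_disjoint_on_Ioo_succ
  calc _ ≤ ∑' k : ℕ, 2 * ∫⁻ s in Ioo (scale t k) (scale t (k + 1)),
        ENNReal.ofReal ((1 + Real.log (s / t))⁻¹ * φ (1 + Real.log (s / t))) * h s *
          ENNReal.ofReal (1 / s) :=
        ENNReal.tsum_le_tsum fun k => mul_scale_le_setLIntegral hφ hh ht k
    _ = 2 * ∫⁻ s in ⋃ k : ℕ, Ioo (scale t k) (scale t (k + 1)),
        ENNReal.ofReal ((1 + Real.log (s / t))⁻¹ * φ (1 + Real.log (s / t))) * h s *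
          ENNReal.ofReal (1 / s) := by
        rw [ENNReal.tsum_mul_left, lintegral_iUnion (fun _ => measurableSet_Ioo) hdisj]
    _ ≤ _ := by
        unfold calderonQ
        gcongr
        refine iUnion_subset fun k s hs => ?_
        have := scale_monotone ht (Nat.zero_le k)
        rw [scale_zero] at this
        exact this.trans_lt hs.1

theorem le_hardyP {h : ℝ → ℝ≥0∞} (hh : Antitone h) {t : ℝ} (ht : 0 < t) : h t ≤ hardyP h t := by
  calc h t = ENNReal.ofReal (1 / t) * ∫⁻ _ in Ioo 0 t, h t := by
        rw [setLIntegral_const, Real.volume_Ioo, sub_zero, mul_comm (h t), ← mul_assoc,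
          ← ENNReal.ofReal_mul (by positivity), one_div_mul_cancel ht.ne', ENNReal.ofReal_one,
          one_mul]
    _ ≤ _ := by
        unfold hardyP
        gcongr 1
        exact setLIntegral_mono' measurableSet_Ioo fun s hs => hh hs.2.le

/-- The term `k = 0` is a multiple of `h t` and goes to the Hardy term. The others, shifted by one,
go to the Calderón term; the shift and `K` together cost `(4K)^β`. -/
theorem tsum_mul_scale_le (hφ : IsAdmissible φ) {β : ℝ}
    (hβ : ∀ A x : ℝ, 1 ≤ A → 1 ≤ x → φ (A * x) ≤ A ^ β * φ x) (hβ0 : 0 < β) {K : ℝ} (hK : 1 ≤ K)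
    {h : ℝ → ℝ≥0∞} (hh : Antitone h) {t : ℝ} (ht : 0 < t) :
    ∑' k : ℕ, ENNReal.ofReal (φ (K * 2 ^ (k + 1))) * h (scale t k) ≤
      ENNReal.ofReal (2 * (4 * K) ^ β) * (hardyP h t + calderonQ φ h t) := by
  set c := ENNReal.ofReal ((4 * K) ^ β) with hc
  have h0 : ENNReal.ofReal (φ (K * 2 ^ (0 + 1))) * h (scale t 0) ≤ c * hardyP h t := by
    rw [scale_zero]
    gcongr
    · have h1 := hβ (2 * K) 1 (by linarith) le_rfl
      rw [hφ.map_one, mul_one, mul_one] at h1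
      rw [show K * 2 ^ (0 + 1) = 2 * K by ring]
      exact ENNReal.ofReal_le_ofReal (h1.trans (by gcongr; norm_num))
    · exact le_hardyP hh ht
  have h1 : ∀ k : ℕ, ENNReal.ofReal (φ (K * 2 ^ (k + 1 + 1))) * h (scale t (k + 1)) ≤
      c * (ENNReal.ofReal (φ (2 ^ k)) * h (scale t (k + 1))) := fun k => by
    rw [← mul_assoc, hc, ← ENNReal.ofReal_mul (by positivity)]
    gcongr
    rw [show K * 2 ^ (k + 1 + 1) = 4 * K * 2 ^ k by ring]
    exact hβ _ _ (by linarith) (one_le_pow₀ (by norm_num))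
  rw [tsum_eq_zero_add' ENNReal.summable]
  calc _ ≤ c * hardyP h t + c * (2 * calderonQ φ h t) := by
        refine add_le_add h0 ((ENNReal.tsum_le_tsum h1).trans ?_)
        rw [ENNReal.tsum_mul_left]
        gcongr
        exact tsum_mul_scale_le_calderonQ hφ hh ht
    _ ≤ c * (2 * hardyP h t) + c * (2 * calderonQ φ h t) := by
        gcongr
        exact le_mul_of_one_le_left' one_le_two
    _ = _ := by
        rw [ENNReal.ofReal_mul (by norm_num), ENNReal.ofReal_ofNat]
        ring

end Admissible

/-! ### Countable sublinearity and the estimate for one slice -/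

section Operator

variable {𝕜 : Type*} [RCLike 𝕜] {n : ℕ} {p : ℝ} {T : ((Fin n → ℝ) → 𝕜) → ((Fin n → ℝ) → 𝕜)}

theorem ae_volume_of_ae_weighted {u : (Fin n → ℝ) → ℝ≥0∞} (hu : IsMuckenhoupt p u)
    {P : (Fin n → ℝ) → Prop} (h : ∀ᵐ x ∂(weighted u), P x) : ∀ᵐ x, P x :=
  (withDensity_absolutelyContinuous' hu.measurable.aemeasurable
    (hu.pos.mono fun _ hx => hx.ne')).ae_le h

theorem aestronglyMeasurable_weighted {u : (Fin n → ℝ) → ℝ≥0∞} {f : (Fin n → ℝ) → 𝕜}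
    (hf : AEStronglyMeasurable f volume) : AEStronglyMeasurable f (weighted u) :=
  hf.mono_ac (withDensity_absolutelyContinuous _ _)

theorem aestronglyMeasurable_of_mem_lorentzSum {f : (Fin n → ℝ) → 𝕜}
    (hf : f ∈ lorentzSum 𝕜 n p) : AEStronglyMeasurable f volume := by
  refine Submodule.span_induction ?_ aestronglyMeasurable_zero
    (fun _ _ _ _ h1 h2 => h1.add h2) (fun c _ _ h => h.const_smul c) hf
  rintro f (hf | ⟨u, _, hf⟩)
  · exact hf.1
  · exact hf.1

theorem IsSublinearOn.zero {D : Submodule 𝕜 ((Fin n → ℝ) → 𝕜)} (hT : IsSublinearOn D T) :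
    ∀ᵐ x, T 0 x = 0 := by
  filter_upwards [hT.smul_eq 0 0 D.zero_mem] with x hx
  simpa using hx

theorem memLp_indicator {f : (Fin n → ℝ) → 𝕜} (hf : MemLp f 1 volume) {G : Set (Fin n → ℝ)}
    (hG : NullMeasurableSet G volume) : MemLp (G.indicator f) 1 volume :=
  hf.of_le (hf.1.indicator₀ hG) (ae_of_all _ fun _ => norm_indicator_le_norm_self _ _)

theorem memLorentzOne_indicator {u : (Fin n → ℝ) → ℝ≥0∞} {f : (Fin n → ℝ) → 𝕜}
    (hf : MemLorentzOne p u f) {G : Set (Fin n → ℝ)} (hG : NullMeasurableSet G volume) :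
    MemLorentzOne p u (G.indicator f) := by
  refine ⟨hf.1.indicator₀ hG, lt_of_le_of_lt (lintegral_mono fun s => ?_) hf.2⟩
  dsimp only
  gcongr
  exact rearr_mono_ae (ae_of_all _ fun x => enorm_indicator_le_enorm_self _ _) s

theorem tendsto_eLpNorm_one_indicator {f : (Fin n → ℝ) → 𝕜} (hf : MemLp f 1 volume)
    {G : ℕ → Set (Fin n → ℝ)} (hG : ∀ k, NullMeasurableSet (G k) volume) (hanti : Antitone G)
    (hempty : ⋂ k, G k = ∅) :
    Tendsto (fun k => eLpNorm ((G k).indicator f) 1 volume) atTop (𝓝 0) := by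
  have := tendsto_lintegral_of_dominated_convergence' (μ := (volume : Measure (Fin n → ℝ)))
    (F := fun k x => ‖(G k).indicator f x‖ₑ) (f := fun _ => 0) (fun x => ‖f x‖ₑ)
    (fun k => (hf.1.indicator₀ (hG k)).enorm)
    (fun k => ae_of_all _ fun x => enorm_indicator_le_enorm_self _ _)
    (by rw [← eLpNorm_one_eq_lintegral_enorm]; exact hf.2.ne)
    (ae_of_all _ fun x => by
      obtain ⟨N, hN⟩ : ∃ N, x ∉ G N := by
        have : x ∉ ⋂ k, G k := by simp [hempty]
        simpa using this
      refine tendsto_const_nhds.congr' ?_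
      filter_upwards [eventually_ge_atTop N] with k hk
      have : x ∉ G k := fun h => hN (hanti hk h)
      simp [indicator_of_notMem this])
  simpa [eLpNorm_one_eq_lintegral_enorm] using this

/-- Along a decreasing sequence of sets with empty intersection, `T (1_G f)` tends to `0` almost
everywhere for a subsequence. -/
theorem exists_seq_tendsto_indicator (hp : 0 < p) {C₁ : ℝ≥0∞} (hC₁ : C₁ ≠ ∞)
    {B : ((Fin n → ℝ) → ℝ≥0∞) → ℝ≥0∞} (hB : ∀ u, B u ≠ ∞)
    (hT : IsSublinearOn (lorentzSum 𝕜 n p) T)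
    (h1 : ∀ f : (Fin n → ℝ) → 𝕜, MemLp f 1 volume →
      lorentzWeakNorm 1 volume (T f) ≤ C₁ * eLpNorm f 1 volume)
    (h2 : ∀ u : (Fin n → ℝ) → ℝ≥0∞, IsMuckenhoupt p u →
      ∀ f : (Fin n → ℝ) → 𝕜, MemLorentzOne p u f →
        lorentzWeakNorm p (weighted u) (T f) ≤ B u * lorentzOneNorm p (weighted u) f)
    {f : (Fin n → ℝ) → 𝕜} (hf : f ∈ lorentzSum 𝕜 n p) :
    ∀ G : ℕ → Set (Fin n → ℝ), (∀ k, NullMeasurableSet (G k) volume) → Antitone G →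
      ⋂ k, G k = ∅ → (∀ k, (G k).indicator f ∈ lorentzSum 𝕜 n p) ∧
        ∃ ns : ℕ → ℕ, StrictMono ns ∧
          ∀ᵐ x, Tendsto (fun i => T ((G (ns i)).indicator f) x) atTop (𝓝 0) := by
  have hsubseq : ∀ G : ℕ → Set (Fin n → ℝ), Antitone G → ⋂ k, G k = ∅ →
      ∀ ns : ℕ → ℕ, StrictMono ns → ⋂ k, G (ns k) = ∅ := by
    intro G hanti hemp ns hns
    refine subset_empty_iff.1 (hemp ▸ ?_)
    exact subset_iInter fun k => (iInter_subset _ k).trans (hanti (hns.id_le k))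
  -- On a generator, order continuity of its norm and the bound on `T` give convergence in measure,
  -- hence almost everywhere for a subsequence.
  refine Submodule.span_induction ?_ ?_ ?_ ?_ hf
  · rintro f (hf | ⟨u, hu, hf⟩) G hG hanti hemp
    · have hmem : ∀ k, MemLp ((G k).indicator f) 1 volume := fun k => memLp_indicator hf (hG k)
      refine ⟨fun k => Submodule.subset_span (Or.inl (hmem k)), ?_⟩
      refine (tendstoInMeasure_of_lorentzWeakNorm (p := 1)
        (f := fun k => T ((G k).indicator f)) ?_).exists_seq_tendsto_ae
      refine tendsto_of_tendsto_of_tendsto_of_le_of_le tendsto_const_nhds ?_ (fun _ => zero_le)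
        (fun k => h1 _ (hmem k))
      simpa using ENNReal.Tendsto.const_mul (a := C₁)
        (tendsto_eLpNorm_one_indicator hf hG hanti hemp) (Or.inr hC₁)
    · have hmem : ∀ k, MemLorentzOne p u ((G k).indicator f) := fun k =>
        memLorentzOne_indicator hf (hG k)
      refine ⟨fun k => Submodule.subset_span (Or.inr ⟨u, hu, hmem k⟩), ?_⟩
      obtain ⟨ns, hns, hae⟩ := (tendstoInMeasure_of_lorentzWeakNorm (p := p) (μ := weighted u)
        (f := fun k => T ((G k).indicator f)) (by
          refine tendsto_of_tendsto_of_tendsto_of_le_of_le tendsto_const_nhds ?_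
            (fun _ => zero_le) (fun k => h2 u hu _ (hmem k))
          simpa using ENNReal.Tendsto.const_mul (a := B u)
            (tendsto_lorentzOneNorm_indicator hp (aestronglyMeasurable_weighted (u := u) hf.1) hf.2
              (fun k => (hG k).mono_ac (withDensity_absolutelyContinuous _ _)) hanti hemp)
            (Or.inr (hB u)))).exists_seq_tendsto_ae
      exact ⟨ns, hns, ae_volume_of_ae_weighted hu hae⟩
  · intro G hG hanti hemp
    simp only [indicator_zero']
    refine ⟨fun _ => Submodule.zero_mem _, id, strictMono_id, ?_⟩
    filter_upwards [hT.zero] with x hx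
    simp [hx]
  · intro f g _ _ hf hg G hG hanti hemp
    obtain ⟨hfD, ns, hns, hfl⟩ := hf G hG hanti hemp
    -- The second summand is handled along the subsequence already chosen for the first; this is why
    -- the claim is quantified over all sequences `G`.
    obtain ⟨hgD, ms, hms, hgl⟩ := hg (fun k => G (ns k)) (fun k => hG _)
      (hanti.comp_monotone hns.monotone) (hsubseq G hanti hemp ns hns)
    have hgD' := (hg G hG hanti hemp).1
    simp only [indicator_add']
    refine ⟨fun k => Submodule.add_mem _ (hfD k) (hgD' k), ns ∘ ms, hns.comp hms, ?_⟩
    filter_upwards [hfl, hgl, ae_all_iff.2 fun k => hT.add_le _ (hfD k) _ (hgD' k)]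
      with x hx1 hx2 hx3
    refine squeeze_zero_norm (fun i => hx3 _) ?_
    simpa using (hx1.comp hms.tendsto_atTop).norm.add hx2.norm
  · intro c f _ hf G hG hanti hemp
    obtain ⟨hfD, ns, hns, hfl⟩ := hf G hG hanti hemp
    have hsmul : ∀ k, (G k).indicator (c • f) = c • (G k).indicator f := fun k =>
      indicator_const_smul (G k) c f
    simp only [hsmul]
    refine ⟨fun k => Submodule.smul_mem _ _ (hfD k), ns, hns, ?_⟩
    filter_upwards [hfl, ae_all_iff.2 fun k => hT.smul_eq c _ (hfD k)] with x hx1 hx2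
    refine squeeze_zero_norm (fun i => (hx2 _).le) ?_
    simpa using hx1.norm.const_mul ‖c‖

/-- The part of `f` with values in `(b, a]`. -/
def slice (f : (Fin n → ℝ) → 𝕜) (b a : ℝ≥0∞) : (Fin n → ℝ) → 𝕜 :=
  {x | b < ‖f x‖ₑ ∧ ‖f x‖ₑ ≤ a}.indicator f

/-- Countable sublinearity along the horizontal slices of `f`. -/
theorem enorm_le_tsum_slice (hp : 0 < p) {C₁ : ℝ≥0∞} (hC₁ : C₁ ≠ ∞)
    {B : ((Fin n → ℝ) → ℝ≥0∞) → ℝ≥0∞} (hB : ∀ u, B u ≠ ∞)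
    (hT : IsSublinearOn (lorentzSum 𝕜 n p) T)
    (h1 : ∀ f : (Fin n → ℝ) → 𝕜, MemLp f 1 volume →
      lorentzWeakNorm 1 volume (T f) ≤ C₁ * eLpNorm f 1 volume)
    (h2 : ∀ u : (Fin n → ℝ) → ℝ≥0∞, IsMuckenhoupt p u →
      ∀ f : (Fin n → ℝ) → 𝕜, MemLorentzOne p u f →
        lorentzWeakNorm p (weighted u) (T f) ≤ B u * lorentzOneNorm p (weighted u) f)
    {f : (Fin n → ℝ) → 𝕜} (hf : f ∈ lorentzSum 𝕜 n p) {a : ℕ → ℝ≥0∞} (ha : Antitone a)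
    (ha0 : Tendsto a atTop (𝓝 0))
    (htop : slice f (a 0) ∞ ∈ lorentzSum 𝕜 n p)
    (hslice : ∀ k, slice f (a (k + 1)) (a k) ∈ lorentzSum 𝕜 n p) :
    ∀ᵐ x, ‖T f x‖ₑ ≤ ‖T (slice f (a 0) ∞) x‖ₑ + ∑' k, ‖T (slice f (a (k + 1)) (a k)) x‖ₑ := by
  have hfm := aestronglyMeasurable_of_mem_lorentzSum hf
  set G : ℕ → Set (Fin n → ℝ) := fun k => {x | 0 < ‖f x‖ₑ ∧ ‖f x‖ₑ ≤ a k} with hGdef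
  have hG : ∀ k, NullMeasurableSet (G k) volume := fun k =>
    (nullMeasurableSet_lt aemeasurable_const hfm.enorm).inter
      (nullMeasurableSet_le hfm.enorm aemeasurable_const)
  have hanti : Antitone G := fun i j hij x hx => ⟨hx.1, hx.2.trans (ha hij)⟩
  have hemp : ⋂ k, G k = ∅ := by
    refine eq_empty_of_forall_notMem fun x hx => ?_
    rw [mem_iInter] at hx
    exact absurd (ge_of_tendsto' ha0 fun k => (hx k).2) (not_le.2 (hx 0).1)
  obtain ⟨hGD, ns, hns, hlim⟩ :=
    exists_seq_tendsto_indicator hp hC₁ hB hT h1 h2 hf G hG hanti hemp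
  have hsplit0 : f = slice f (a 0) ∞ + (G 0).indicator f := by
    funext x
    by_cases h0 : f x = 0
    · simp [slice, indicator_apply, h0]
    · have hpos : 0 < ‖f x‖ₑ := by simpa using h0
      rcases lt_or_ge (a 0) ‖f x‖ₑ with h | h
      · simp [slice, hGdef, h]
      · simp [slice, hGdef, indicator_apply, h, not_lt.2 h]
  have hsplit : ∀ k, (G k).indicator f =
      slice f (a (k + 1)) (a k) + (G (k + 1)).indicator f := by
    intro k
    funext x
    by_cases h0 : f x = 0
    · simp [slice, indicator_apply, h0]
    · have hpos : 0 < ‖f x‖ₑ := by simpa using h0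
      rcases lt_or_ge (a (k + 1)) ‖f x‖ₑ with h | h
      · simp [slice, hGdef, indicator_apply, h, h0, not_le.2 h]
      · simp [slice, hGdef, indicator_apply, h, not_lt.2 h, h.trans (ha k.le_succ)]
  have hadd : ∀ g ∈ lorentzSum 𝕜 n p, ∀ h ∈ lorentzSum 𝕜 n p,
      ∀ᵐ x, ‖T (g + h) x‖ₑ ≤ ‖T g x‖ₑ + ‖T h x‖ₑ := by
    intro g hg h hh
    filter_upwards [hT.add_le g hg h hh] with x hx
    rw [← ofReal_norm, ← ofReal_norm, ← ofReal_norm,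
      ← ENNReal.ofReal_add (norm_nonneg _) (norm_nonneg _)]
    exact ENNReal.ofReal_le_ofReal hx
  filter_upwards [hlim, hadd _ htop _ (hGD 0), ae_all_iff.2 fun k => hadd _ (hslice k) _ (hGD (k + 1))]
    with x hx hx0 hxk
  rw [← hsplit0] at hx0
  simp only [← hsplit] at hxk
  have hfin : ∀ N, ‖T f x‖ₑ ≤ ‖T (slice f (a 0) ∞) x‖ₑ +
      ∑ k ∈ Finset.range N, ‖T (slice f (a (k + 1)) (a k)) x‖ₑ + ‖T ((G N).indicator f) x‖ₑ := by
    intro N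
    induction N with
    | zero => simpa using hx0
    | succ N ih =>
      refine ih.trans ?_
      rw [Finset.sum_range_succ]
      calc _ ≤ _ := add_le_add le_rfl (hxk N)
        _ = _ := by ring
  -- A subsequence is enough here, since every partial sum is below the full series.
  have hlim' : Tendsto (fun i => ‖T (slice f (a 0) ∞) x‖ₑ +
      ∑' k, ‖T (slice f (a (k + 1)) (a k)) x‖ₑ + ‖T ((G (ns i)).indicator f) x‖ₑ) atTop
      (𝓝 (‖T (slice f (a 0) ∞) x‖ₑ + ∑' k, ‖T (slice f (a (k + 1)) (a k)) x‖ₑ + 0)) := by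
    refine tendsto_const_nhds.add ?_
    simpa using hx.enorm
  rw [add_zero] at hlim'
  refine ge_of_tendsto' hlim' fun i => (hfin (ns i)).trans ?_
  gcongr
  exact ENNReal.sum_le_tsum _

theorem setLIntegral_le_setLIntegral_weighted {u : (Fin n → ℝ) → ℝ≥0∞} {E : Set (Fin n → ℝ)}
    (hE : MeasurableSet E) (hu : ∀ x ∈ E, 1 ≤ u x) (g : (Fin n → ℝ) → ℝ≥0∞) :
    ∫⁻ x in E, g x ≤ ∫⁻ x in E, g x ∂(weighted u) := by
  refine lintegral_mono' (Measure.le_iff.2 fun A hA => ?_) le_rfl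
  rw [Measure.restrict_apply hA, Measure.restrict_apply hA, weighted,
    withDensity_apply _ (hA.inter hE), ← setLIntegral_one]
  exact setLIntegral_mono' (hA.inter hE) fun x hx => hu x hx.2

/-- The estimate for a bounded function whose support has measure at most `e^{1/δ - 1} |E|`. -/
theorem setLIntegral_enorm_le_of_bounded (hn : 1 ≤ n) (hp : 1 < p) {φ : ℝ → ℝ}
    (hφ : IsAdmissible φ) {C₂ : ℝ≥0}
    (hT : IsSublinearOn (lorentzSum 𝕜 n p) T)
    (h2 : ∀ u : (Fin n → ℝ) → ℝ≥0∞, IsMuckenhoupt p u →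
      ∀ f : (Fin n → ℝ) → 𝕜, MemLorentzOne p u f →
        lorentzWeakNorm p (weighted u) (T f) ≤
          C₂ * ENNReal.ofReal (φ (muckenhouptConst p u).toReal) * lorentzOneNorm p (weighted u) f)
    {E : Set (Fin n → ℝ)} (hE : MeasurableSet E) {t : ℝ} (ht : 0 < t)
    (hEt : volume E = ENNReal.ofReal t) {δ : ℝ} (hδ : 0 < δ) (hδ' : δ ≤ 1)
    {g : (Fin n → ℝ) → 𝕜} (hg : AEStronglyMeasurable g volume) {a : ℝ≥0∞} (hatop : a ≠ ∞)
    (hga : ∀ x, ‖g x‖ₑ ≤ a)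
    (hsupp : volume {x | g x ≠ 0} ≤ ENNReal.ofReal (t * Real.exp (1 / δ - 1))) :
    g ∈ lorentzSum 𝕜 n p ∧ ∫⁻ x in E, ‖T g x‖ₑ ≤
      C₂ * ENNReal.ofReal (p ^ 2 / (p - 1) * (1 + 4 ^ n * 3) * t) *
        (ENNReal.ofReal (φ (3 * 12 ^ n / δ)) * a) := by
  have hp0 : 0 < p := by linarith
  have hp1 : 0 < p - 1 := by linarith
  set m : ℝ := (1 + 4 ^ n * 3) * t with hm
  have hm0 : 0 < m := by positivity
  have hE0 : volume E ≠ 0 := by rw [hEt]; simpa using ht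
  set u := testWeight E δ with hu
  have hmu : IsMuckenhoupt p u := isMuckenhoupt_testWeight hn hE hE0 hδ hδ' hp
  have hmem := muckenhouptConst_testWeight_toReal_mem hn hE hE0 hδ hδ' hp
  have hsupp' : weighted u {x | g x ≠ 0} ≤ ENNReal.ofReal m :=
    weighted_testWeight_le hn hE ht hEt hδ hδ' hsupp
  have hE' : weighted u E ≤ ENNReal.ofReal m := by
    refine weighted_testWeight_le hn hE ht hEt hδ hδ' (hEt.le.trans ?_)
    refine ENNReal.ofReal_le_ofReal (le_mul_of_one_le_right ht.le (Real.one_le_exp ?_))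
    rw [sub_nonneg, one_le_div hδ]
    exact hδ'
  have hnorm := lorentzOneNorm_le_of_le hp0 hm0.le hga hsupp'
  have hgL : MemLorentzOne p u g :=
    ⟨hg, hnorm.trans_lt (ENNReal.mul_lt_top hatop.lt_top ENNReal.ofReal_lt_top)⟩
  have hgD : g ∈ lorentzSum 𝕜 n p := Submodule.subset_span (Or.inr ⟨u, hmu, hgL⟩)
  refine ⟨hgD, ?_⟩
  have hφle : φ (muckenhouptConst p u).toReal ≤ φ (3 * 12 ^ n / δ) :=
    hφ.monotoneOn hmem.1 (hmem.1.trans hmem.2) hmem.2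
  calc ∫⁻ x in E, ‖T g x‖ₑ ≤ ∫⁻ x in E, ‖T g x‖ₑ ∂(weighted u) :=
        setLIntegral_le_setLIntegral_weighted hE (fun x hx => one_le_testWeight hx) _
    _ ≤ lorentzWeakNorm p (weighted u) (T g) *
          ENNReal.ofReal (m ^ (1 - 1 / p) / (1 - 1 / p)) :=
        setLIntegral_enorm_le_lorentzWeakNorm hp
          (aestronglyMeasurable_weighted (hT.aestronglyMeasurable g hgD)) hm0.le hE'
    _ ≤ C₂ * ENNReal.ofReal (φ (3 * 12 ^ n / δ)) * (a * ENNReal.ofReal (p * m ^ (1 / p))) *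
          ENNReal.ofReal (m ^ (1 - 1 / p) / (1 - 1 / p)) := by
        gcongr
        refine (h2 u hmu g hgL).trans ?_
        gcongr
    _ = C₂ * (ENNReal.ofReal (p * m ^ (1 / p)) *
          ENNReal.ofReal (m ^ (1 - 1 / p) / (1 - 1 / p))) *
          (ENNReal.ofReal (φ (3 * 12 ^ n / δ)) * a) := by ring
    _ = _ := by
        rw [← ENNReal.ofReal_mul (by positivity)]
        congr 3
        -- The support and `E` both have weighted measure at most `m`, so the powers of `m` from the
        -- two Lorentz norms combine to `m` itself, linear in `t`.
        have h3 : m ^ (1 / p) * m ^ (1 - 1 / p) = m := by rw [← Real.rpow_add hm0]; simp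
        calc p * m ^ (1 / p) * (m ^ (1 - 1 / p) / (1 - 1 / p))
            = p * (m ^ (1 / p) * m ^ (1 - 1 / p)) / (1 - 1 / p) := by ring
          _ = p ^ 2 / (p - 1) * m := by rw [h3]; field_simp
          _ = _ := by rw [hm]; ring

end Operator

/-! ### The pointwise estimate and passage to limits -/

section Main

variable {𝕜 : Type*} [RCLike 𝕜] {n : ℕ} {p : ℝ} {T : ((Fin n → ℝ) → 𝕜) → ((Fin n → ℝ) → 𝕜)}

/-- The pointwise estimate on the span, with an explicit constant. -/
theorem rearr_le_of_mem_lorentzSum (hn : 1 ≤ n) (hp : 1 < p) {φ : ℝ → ℝ} (hφ : IsAdmissible φ)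
    {β : ℝ} (hβ : ∀ A x : ℝ, 1 ≤ A → 1 ≤ x → φ (A * x) ≤ A ^ β * φ x) (hβ0 : 0 < β)
    {C₁ C₂ : ℝ≥0} (hT : IsSublinearOn (lorentzSum 𝕜 n p) T)
    (h1 : ∀ f : (Fin n → ℝ) → 𝕜, MemLp f 1 volume →
      lorentzWeakNorm 1 volume (T f) ≤ C₁ * eLpNorm f 1 volume)
    (h2 : ∀ u : (Fin n → ℝ) → ℝ≥0∞, IsMuckenhoupt p u →
      ∀ f : (Fin n → ℝ) → 𝕜, MemLorentzOne p u f →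
        lorentzWeakNorm p (weighted u) (T f) ≤
          C₂ * ENNReal.ofReal (φ (muckenhouptConst p u).toReal) * lorentzOneNorm p (weighted u) f)
    {f : (Fin n → ℝ) → 𝕜} (hf : f ∈ lorentzSum 𝕜 n p) {t : ℝ} (ht : 0 < t)
    (hfin : hardyP (rearr volume f) t + calderonQ φ (rearr volume f) t ≠ ∞) :
    rearr volume (T f) t ≤
      (4 * C₁ + 4 * (C₂ * ENNReal.ofReal (p ^ 2 / (p - 1) * (1 + 4 ^ n * 3)) *
        ENNReal.ofReal (2 * (4 * (3 * 12 ^ n)) ^ β))) *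
      (hardyP (rearr volume f) t + calderonQ φ (rearr volume f) t) := by
  have hp1 : 0 < p - 1 := by linarith
  have hK : (1 : ℝ) ≤ 3 * 12 ^ n := by
    have : (1 : ℝ) ≤ 12 ^ n := one_le_pow₀ (by norm_num)
    linarith
  set P := hardyP (rearr volume f) t with hP
  set Q := calderonQ φ (rearr volume f) t with hQ
  set c₁ := ENNReal.ofReal (p ^ 2 / (p - 1) * (1 + 4 ^ n * 3)) with hc₁
  set c₂ := ENNReal.ofReal (2 * (4 * (3 * 12 ^ n)) ^ β) with hc₂
  have hfm := aestronglyMeasurable_of_mem_lorentzSum hf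
  set a : ℕ → ℝ≥0∞ := fun k => rearr volume f (scale t k) with ha_def
  have ha : Antitone a := fun i j hij => rearr_antitone _ _ (scale_monotone ht hij)
  have hsum : ∑' k : ℕ, ENNReal.ofReal (φ (3 * 12 ^ n * 2 ^ (k + 1))) * a k ≤ c₂ * (P + Q) :=
    tsum_mul_scale_le hφ hβ hβ0 hK (rearr_antitone _ _) ht
  have hsum_top : ∑' k : ℕ, ENNReal.ofReal (φ (3 * 12 ^ n * 2 ^ (k + 1))) * a k ≠ ∞ :=
    (hsum.trans_lt (ENNReal.mul_lt_top ENNReal.ofReal_lt_top hfin.lt_top)).ne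
  -- Since `φ ≥ 1`, convergence of the weighted series forces each `a k` to be finite and `a k → 0`.
  have ha_le : ∀ k, a k ≤ ENNReal.ofReal (φ (3 * 12 ^ n * 2 ^ (k + 1))) * a k := fun k => by
    refine le_mul_of_one_le_left' ?_
    rw [ENNReal.one_le_ofReal]
    exact hφ.one_le _ (one_le_mul_of_one_le_of_one_le hK (one_le_pow₀ (by norm_num)))
  have ha_top : ∀ k, a k ≠ ∞ := fun k =>
    ((ha_le k).trans_lt (ENNReal.lt_top_of_tsum_ne_top hsum_top k)).ne
  have ha0 : Tendsto a atTop (𝓝 0) :=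
    tendsto_of_tendsto_of_tendsto_of_le_of_le tendsto_const_nhds
      (ENNReal.tendsto_atTop_zero_of_tsum_ne_top hsum_top) (fun _ => zero_le) ha_le
  have hlevel : ∀ k, volume {x | a k < ‖f x‖ₑ} ≤ ENNReal.ofReal (scale t k) := fun k =>
    measure_rearr_lt_le _ _ _
  have hset : ∀ b b' : ℝ≥0∞, NullMeasurableSet {x | b < ‖f x‖ₑ ∧ ‖f x‖ₑ ≤ b'} volume :=
    fun b b' => (nullMeasurableSet_lt aemeasurable_const hfm.enorm).inter
      (nullMeasurableSet_le hfm.enorm aemeasurable_const)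
  have hslice_meas : ∀ b b' : ℝ≥0∞, AEStronglyMeasurable (slice f b b') volume :=
    fun b b' => hfm.indicator₀ (hset b b')
  have hlarge : eLpNorm (slice f (a 0) ∞) 1 volume ≤ ENNReal.ofReal t * P := by
    have h0 := hlevel 0
    rw [scale_zero] at h0
    calc eLpNorm (slice f (a 0) ∞) 1 volume
        = ∫⁻ x in {x | a 0 < ‖f x‖ₑ ∧ ‖f x‖ₑ ≤ ∞}, ‖f x‖ₑ := by
          rw [eLpNorm_one_eq_lintegral_enorm, ← lintegral_indicator₀ (hset _ _)]
          simp only [slice, enorm_indicator_eq_indicator_enorm]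
      _ ≤ ∫⁻ s in Ioo 0 t, rearr volume f s := by
          refine setLIntegral_enorm_le_rearr hfm ((measure_mono fun x hx => ?_).trans h0)
          exact hx.1
      _ = ENNReal.ofReal t * P := by
          rw [hP, hardyP, ← mul_assoc, ← ENNReal.ofReal_mul ht.le, mul_one_div_cancel ht.ne',
            ENNReal.ofReal_one, one_mul]
  have hP_top : P ≠ ∞ := (ENNReal.add_ne_top.1 hfin).1
  have hlargeL : MemLp (slice f (a 0) ∞) 1 volume :=
    ⟨hslice_meas _ _, hlarge.trans_lt (ENNReal.mul_lt_top ENNReal.ofReal_lt_top hP_top.lt_top)⟩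
  have hlargeD : slice f (a 0) ∞ ∈ lorentzSum 𝕜 n p := Submodule.subset_span (Or.inl hlargeL)
  have hlargeT : rearr volume (T (slice f (a 0) ∞)) (t / 2) ≤ 2 * (C₁ * P) := by
    calc _ ≤ lorentzWeakNorm 1 volume (T (slice f (a 0) ∞)) *
          ENNReal.ofReal ((t / 2) ^ (-(1 / 1) : ℝ)) := rearr_le_lorentzWeakNorm (by positivity)
      _ ≤ C₁ * (ENNReal.ofReal t * P) * ENNReal.ofReal (2 / t) := by
          gcongr
          · exact (h1 _ hlargeL).trans (by gcongr)
          · rw [div_one, Real.rpow_neg_one, inv_div]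
      _ = C₁ * P * (ENNReal.ofReal t * ENNReal.ofReal (2 / t)) := by ring
      _ = _ := by
          rw [← ENNReal.ofReal_mul ht.le, mul_div_cancel₀ _ ht.ne', ENNReal.ofReal_ofNat,
            mul_comm]
  -- The parameter is `δ = 2^{-(k+1)}`, for which `t e^{1/δ - 1}` is exactly `scale t (k + 1)`. Any
  -- `s ≥ t` is allowed, since the level set contains `E` with `|E| > t`, not `|E| = t`.
  have hsmall : ∀ (E : Set (Fin n → ℝ)) (s : ℝ), MeasurableSet E → t ≤ s →
      volume E = ENNReal.ofReal s → ∀ k, slice f (a (k + 1)) (a k) ∈ lorentzSum 𝕜 n p ∧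
        ∫⁻ x in E, ‖T (slice f (a (k + 1)) (a k)) x‖ₑ ≤
          C₂ * c₁ * ENNReal.ofReal s *
            (ENNReal.ofReal (φ (3 * 12 ^ n * 2 ^ (k + 1))) * a k) := by
    intro E s hE hts hEs k
    have hpow : (0 : ℝ) < 2 ^ (k + 1) := by positivity
    have := setLIntegral_enorm_le_of_bounded hn hp hφ hT h2 hE (ht.trans_le hts) hEs
      (inv_pos.2 hpow) (inv_le_one_of_one_le₀ (one_le_pow₀ (by norm_num)))
      (hslice_meas (a (k + 1)) (a k)) (ha_top k)
      (fun x => by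
        by_cases hx : a (k + 1) < ‖f x‖ₑ ∧ ‖f x‖ₑ ≤ a k
        · simp [slice, hx]
        · simp [slice, hx])
      (by
        rw [one_div, inv_inv]
        refine (measure_mono fun x hx => ?_).trans ((hlevel (k + 1)).trans
          (ENNReal.ofReal_le_ofReal (mul_le_mul_of_nonneg_right hts (Real.exp_pos _).le)))
        by_contra hcon
        refine hx (indicator_of_notMem (fun h => hcon h.1) _))
    rwa [div_inv_eq_mul, ENNReal.ofReal_mul (by positivity), ← hc₁, ← mul_assoc (C₂ : ℝ≥0∞)] at this
  refine le_of_forall_lt_imp_le_of_dense fun lam hlam => ?_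
  have hgt : ENNReal.ofReal t < volume {x | lam < ‖T f x‖ₑ} := by
    by_contra hcon
    exact absurd (rearr_le_of_measure_le (not_lt.1 hcon)) (not_le.2 hlam)
  have hlam_top : lam ≠ ∞ := hlam.ne_top
  have hTfm := hT.aestronglyMeasurable f hf
  obtain ⟨S, hSsub, hSm, hSae⟩ := (nullMeasurableSet_lt (aemeasurable_const (b := lam))
    hTfm.enorm).exists_measurable_subset_ae_eq
  rw [← measure_congr hSae] at hgt
  obtain ⟨E, hEm, hES, hEt, hEtop⟩ := Measure.exists_subset_measure_lt_top hSm hgt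
  set s := (volume E).toReal with hs
  have hEs : volume E = ENNReal.ofReal s := (ENNReal.ofReal_toReal hEtop.ne).symm
  have hts : t ≤ s := by
    rw [hEs] at hEt
    exact ((ENNReal.ofReal_lt_ofReal_iff_of_nonneg ht.le).1 hEt).le
  have hs0 : 0 < s := ht.trans_le hts
  have hslice := hsmall E s hEm hts hEs
  have hsub := enorm_le_tsum_slice (T := T) (by linarith : 0 < p) (C₁ := C₁) ENNReal.coe_ne_top
    (B := fun u => C₂ * ENNReal.ofReal (φ (muckenhouptConst p u).toReal))
    (fun u => ENNReal.mul_ne_top ENNReal.coe_ne_top ENNReal.ofReal_ne_top) hT h1 h2 hf ha ha0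
    hlargeD fun k => (hslice k).1
  set g : (Fin n → ℝ) → ℝ≥0∞ := fun x => ∑' k, ‖T (slice f (a (k + 1)) (a k)) x‖ₑ with hg
  have hgE : ∫⁻ x in E, g x ≤ C₂ * c₁ * ENNReal.ofReal s * (c₂ * (P + Q)) := by
    rw [hg, lintegral_tsum fun k =>
      (hT.aestronglyMeasurable _ (hslice k).1).enorm.restrict]
    calc _ ≤ ∑' k, C₂ * c₁ * ENNReal.ofReal s *
          (ENNReal.ofReal (φ (3 * 12 ^ n * 2 ^ (k + 1))) * a k) :=
          ENNReal.tsum_le_tsum fun k => (hslice k).2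
      _ ≤ _ := by
          rw [ENNReal.tsum_mul_left]
          gcongr
  -- Either the top part alone accounts for `lam / 2`, or it exceeds `lam / 2` only on a set of
  -- measure at most `t / 2 ≤ s / 2`. In the second case the slices together reach `lam / 2` on at
  -- least half of `E`.
  rcases le_or_gt (lam / 2) (rearr volume (T (slice f (a 0) ∞)) (t / 2)) with hcase | hcase
  · calc lam = lam / 2 * 2 := (ENNReal.div_mul_cancel (by simp) (by simp)).symm
      _ ≤ 2 * (C₁ * P) * 2 := by
          gcongr
          exact hcase.trans hlargeT
      _ = 4 * C₁ * P := by ring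
      _ ≤ _ := by
          gcongr
          · exact le_self_add
          · exact le_self_add
  · have hbad : volume (E ∩ {x | lam / 2 < ‖T (slice f (a 0) ∞) x‖ₑ}) ≤ ENNReal.ofReal (s / 2) :=
      (measure_mono inter_subset_right).trans ((measure_le_of_rearr_le hcase.le).trans
        (ENNReal.ofReal_le_ofReal (by linarith)))
    have hgood : ENNReal.ofReal (s / 2) ≤
        volume.restrict E {x | lam / 2 ≤ g x} := by
      have hcov : volume E ≤ volume (E ∩ {x | lam / 2 < ‖T (slice f (a 0) ∞) x‖ₑ}) +
          volume ({x | lam / 2 ≤ g x} ∩ E) := by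
        refine (measure_mono_ae ?_).trans (measure_union_le _ _)
        filter_upwards [hsub] with x hx hxE
        by_cases hxb : lam / 2 < ‖T (slice f (a 0) ∞) x‖ₑ
        · exact Or.inl ⟨hxE, hxb⟩
        · refine Or.inr ⟨?_, hxE⟩
          have hlt : lam < ‖T f x‖ₑ := hSsub (hES hxE)
          have h3 : lam / 2 + lam / 2 ≤ lam / 2 + g x := by
            rw [ENNReal.add_halves]
            exact hlt.le.trans (hx.trans (by gcongr; exact not_lt.1 hxb))
          exact (ENNReal.add_le_add_iff_left
            (ENNReal.div_ne_top hlam_top (by simp))).1 h3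
      rw [Measure.restrict_apply' hEm]
      have h4 : ENNReal.ofReal (s / 2) + ENNReal.ofReal (s / 2) ≤
          ENNReal.ofReal (s / 2) + volume ({x | lam / 2 ≤ g x} ∩ E) := by
        rw [← ENNReal.ofReal_add (by positivity) (by positivity), add_halves, ← hEs]
        exact hcov.trans (by gcongr)
      exact (ENNReal.add_le_add_iff_left ENNReal.ofReal_ne_top).1 h4
    have hmarkov : lam / 2 * ENNReal.ofReal (s / 2) ≤
        C₂ * c₁ * ENNReal.ofReal s * (c₂ * (P + Q)) := by
      calc _ ≤ lam / 2 * volume.restrict E {x | lam / 2 ≤ g x} := by gcongr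
        _ ≤ ∫⁻ x in E, g x := mul_meas_ge_le_lintegral₀ (AEMeasurable.tsum fun k =>
            (hT.aestronglyMeasurable _ (hslice k).1).enorm.restrict) _
        _ ≤ _ := hgE
    calc lam = lam / 2 * ENNReal.ofReal (s / 2) * ENNReal.ofReal (4 / s) := by
          rw [mul_assoc, ← ENNReal.ofReal_mul (by positivity),
            show s / 2 * (4 / s) = 2 by field_simp; norm_num, ENNReal.ofReal_ofNat,
            ENNReal.div_mul_cancel (by simp) (by simp)]
      _ ≤ C₂ * c₁ * ENNReal.ofReal s * (c₂ * (P + Q)) * ENNReal.ofReal (4 / s) := by gcongr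
      _ = C₂ * c₁ * (c₂ * (P + Q)) * (ENNReal.ofReal s * ENNReal.ofReal (4 / s)) := by ring
      _ = 4 * (C₂ * c₁ * c₂) * (P + Q) := by
          rw [← ENNReal.ofReal_mul hs0.le, mul_div_cancel₀ _ hs0.ne', ENNReal.ofReal_ofNat]
          ring
      _ ≤ _ := by
          gcongr
          exact le_add_self

/-- Fatou's property of the decreasing rearrangement. -/
theorem rearr_le_of_le_liminf {X E : Type*} [MeasurableSpace X] [NormedAddCommGroup E]
    {μ : Measure X} {f : X → E} {g : ℕ → X → E} {t : ℝ} {b : ℝ≥0∞}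
    (h : ∀ᵐ x ∂μ, ‖f x‖ₑ ≤ liminf (fun k => ‖g k x‖ₑ) atTop)
    (hg : ∀ k, rearr μ (g k) t ≤ b) : rearr μ f t ≤ b := by
  refine rearr_le_of_measure_le ?_
  have hmono : Monotone fun N : ℕ => ⋂ k ≥ N, {x | b < ‖g k x‖ₑ} := fun i j hij x hx => by
    rw [mem_iInter₂] at hx ⊢
    exact fun k hk => hx k (hij.trans hk)
  calc μ {x | b < ‖f x‖ₑ} ≤ μ (⋃ N : ℕ, ⋂ k ≥ N, {x | b < ‖g k x‖ₑ}) := by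
        refine measure_mono_ae ?_
        filter_upwards [h] with x hx hbx
        obtain ⟨N, hN⟩ := eventually_atTop.1 (eventually_lt_of_lt_liminf (lt_of_lt_of_le hbx hx))
        exact mem_iUnion.2 ⟨N, mem_iInter₂.2 hN⟩
    _ = ⨆ N : ℕ, μ (⋂ k ≥ N, {x | b < ‖g k x‖ₑ}) := hmono.measure_iUnion
    _ ≤ ENNReal.ofReal t := iSup_le fun N =>
        (measure_mono (biInter_subset_of_mem (mem_Ici.2 le_rfl))).trans
          (measure_le_of_rearr_le (hg N))

theorem hardyP_mono {h h' : ℝ → ℝ≥0∞} (hh : ∀ s, h s ≤ h' s) (t : ℝ) :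
    hardyP h t ≤ hardyP h' t := by
  unfold hardyP
  gcongr
  exact hh _

theorem calderonQ_mono (φ : ℝ → ℝ) {h h' : ℝ → ℝ≥0∞} (hh : ∀ s, h s ≤ h' s) (t : ℝ) :
    calderonQ φ h t ≤ calderonQ φ h' t := by
  unfold calderonQ
  gcongr
  exact hh _

end Main

end WeakToPointwise

end

theorem theorem1p7 {𝕜 : Type*} [RCLike 𝕜] (n : ℕ) (hn : 1 ≤ n) (p₀ : ℝ) (hp₀ : 1 < p₀)
    (φ : ℝ → ℝ) (hφ : WeakToPointwise.IsAdmissible φ) (C₁ C₂ : ℝ≥0) :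
    ∃ C : ℝ≥0, ∀ T : ((Fin n → ℝ) → 𝕜) → ((Fin n → ℝ) → 𝕜),
      WeakToPointwise.IsSublinearOn (WeakToPointwise.lorentzSum 𝕜 n p₀) T →
      (∀ f : (Fin n → ℝ) → 𝕜, MemLp f 1 volume →
        WeakToPointwise.lorentzWeakNorm 1 volume (T f) ≤ C₁ * eLpNorm f 1 volume) →
      (∀ u : (Fin n → ℝ) → ℝ≥0∞, WeakToPointwise.IsMuckenhoupt p₀ u →
        ∀ f : (Fin n → ℝ) → 𝕜, WeakToPointwise.MemLorentzOne p₀ u f →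
          WeakToPointwise.lorentzWeakNorm p₀ (WeakToPointwise.weighted u) (T f) ≤
            C₂ * ENNReal.ofReal (φ (WeakToPointwise.muckenhouptConst p₀ u).toReal) *
              WeakToPointwise.lorentzOneNorm p₀ (WeakToPointwise.weighted u) f) →
      ∀ f : (Fin n → ℝ) → 𝕜,
        (f ∈ WeakToPointwise.lorentzSum 𝕜 n p₀ ∨
          WeakToPointwise.IsLimitFrom (WeakToPointwise.lorentzSum 𝕜 n p₀) T f) →
        ∀ t : ℝ, 0 < t →
          WeakToPointwise.rearr volume (T f) t ≤
            C * (WeakToPointwise.hardyP (WeakToPointwise.rearr volume f) t +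
              WeakToPointwise.calderonQ φ (WeakToPointwise.rearr volume f) t) := by
  obtain ⟨β, hβ0, hβ⟩ := hφ.exists_le_rpow_mul
  -- The final `+ 1` keeps `C` nonzero, so that `C * ∞ = ∞` when the right-hand side is infinite.
  set C : ℝ≥0 := 4 * C₁ + 4 * (C₂ * Real.toNNReal (p₀ ^ 2 / (p₀ - 1) * (1 + 4 ^ n * 3)) *
    Real.toNNReal (2 * (4 * (3 * 12 ^ n)) ^ β)) + 1 with hC
  refine ⟨C, fun T hT h1 h2 => ?_⟩
  have key : ∀ g ∈ WeakToPointwise.lorentzSum 𝕜 n p₀, ∀ t : ℝ, 0 < t →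
      WeakToPointwise.rearr volume (T g) t ≤
        C * (WeakToPointwise.hardyP (WeakToPointwise.rearr volume g) t +
          WeakToPointwise.calderonQ φ (WeakToPointwise.rearr volume g) t) := by
    intro g hg t ht
    by_cases hfin : WeakToPointwise.hardyP (WeakToPointwise.rearr volume g) t +
        WeakToPointwise.calderonQ φ (WeakToPointwise.rearr volume g) t = ∞
    · rw [hfin, ENNReal.mul_top (by simp [hC])]
      exact le_top
    · refine (WeakToPointwise.rearr_le_of_mem_lorentzSum hn hp₀ hφ hβ hβ0 hT h1 h2 hg ht
        hfin).trans ?_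
      gcongr
      rw [hC]
      push_cast
      exact le_self_add
  rintro f (hf | ⟨g, hgD, hgf, -, hlim⟩) t ht
  · exact key f hf t ht
  · refine WeakToPointwise.rearr_le_of_le_liminf hlim fun k => (key (g k) (hgD k) t ht).trans ?_
    have hmono : ∀ s, WeakToPointwise.rearr volume (g k) s ≤ WeakToPointwise.rearr volume f s :=
      WeakToPointwise.rearr_mono_ae ((hgf k).mono fun x hx => enorm_le_iff_norm_le.2 hx)
    gcongr
    · exact WeakToPointwise.hardyP_mono hmono t
    · exact WeakToPointwise.calderonQ_mono φ hmono t
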